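/- Let $k,n,h_1,\dots,h_n$ be non-negative integers, and let $P_1,\dots,P_n$ and $Q_1,\dots,Q_n$ be two $n$-tuples of linear projections $P_j,Q_j:\mathbb{P}^k\dashrightarrow\mathbb{P}^{h_j}$ over $\mathbb{C}$, given by $(h_j+1)\times(k+1)$ matrices of maximal rank $h_j+1$. For $\mathbf X\in\mathbb P^k$ let $$M_{\mathcal X}(\mathbf X)=\begin{pmatrix}P_1&Q_1(\mathbf X)&0&\cdots&0\\ P_2&0&Q_2(\mathbf X)&\cdots&0\\ \vdots&&&\ddots&\vdots\\ P_n&0&0&\cdots&Q_n(\mathbf X)\end{pmatrix},$$ a matrix with $n+k+1$ columns, and let $M_{\mathcal Y}(\mathbf Y)$ be the matrix obtained by exchanging the roles of the $P_j$ and the $Q_j$. The critical loci $\mathcal X,\mathcal Y\subseteq\mathbb P^k$ are the closed subschemes defined by the minors of order $n+k+1$ of $M_{\mathcal X}$ and of $M_{\mathcal Y}$, respectively. The unified critical locus is $$\mathcal U=\{(\mathbf X,\mathbf Y)\in\mathcal X\times\mathcal Y \mid Q_j(\mathbf X)=P_j(\mathbf Y),\ j=1,\dots,n\},$$ where $Q_j(\mathbf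 X)=P_j(\mathbf Y)$ means that the $2\times2$ minors of $(P_j(\mathbf Y)\,|\,Q_j(\mathbf X))$ vanish; let $\pi_1:\mathcal U\to\mathcal X$ and $\pi_2:\mathcal U\to\mathcal Y$ be the projections. Let $(\mathbf X_0,\mathbf Y_0)\in\mathcal U$ be such that $\mathbf X_0$ is a smooth point of the scheme $\mathcal X$ lying on the irreducible component $\mathcal X'$ of $\mathcal X$, and $\mathbf Y_0$ is a smooth point of the scheme $\mathcal Y$ lying on the irreducible component $\mathcal Y'$ of $\mathcal Y$. If $\mathcal X=\mathbb P^k$, assume also that $M_{\mathcal X}(\mathbf X_0)$ has rank $k+n$; if $\mathcal Y=\mathbb P^k$, assume also that $M_{\mathcal Y}(\mathbf Y_0)$ has rank $k+n$. Then $\pi_2\circ\pi_1^{-1}:\mathcal X'\dashrightarrow\mathcal Y'$ is a birational map. That is, there are non-empty Zariski open subsets $A\subseteq\mathcal X'$ and $B\subseteq\mathcal Y'$ such that for each $\mathbf X\in A$ the fibre $\pi_1^{-1}(\mathbf X)$ is a single point $(\mathbf X,\varphi(\mathbf X))$, for each $\mathbf Y\in B$ the fibre $\pi_2^{-1}(\mathbf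 Y)$ is a single point $(\psi(\mathbf Y),\mathbf Y)$, and $\varphi:A\to B$, $\psi:B\to A$ are regular maps inverse to each other. -/

import Mathlib

open MvPolynomial

noncomputable section

namespace CriticalLoci

/-- Complex projective space `ℙ^k`, as a set of points. -/
abbrev ProjSpace (k : ℕ) : Type := Projectivization ℂ (Fin (k + 1) → ℂ)

/-- Polynomials in the homogeneous coordinates of `ℙ^k`. -/
abbrev CoordRing (k : ℕ) : Type := MvPolynomial (Fin (k + 1)) ℂ

/-- The Zariski topology on `ℙ^k`: a basis is given by the sets where a homogeneous polynomial
does not vanish. -/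
instance zariskiTopology (k : ℕ) : TopologicalSpace (ProjSpace k) :=
  TopologicalSpace.generateFrom
    {D | ∃ (d : ℕ) (f : CoordRing k), f.IsHomogeneous d ∧ D = {x | eval x.rep f ≠ 0}}

/-- `Z'` is an irreducible component of `Z ⊆ ℙ^k`: a maximal irreducible subset. -/
def IsIrredComponent {k : ℕ} (Z' Z : Set (ProjSpace k)) : Prop :=
  Maximal (fun S : Set (ProjSpace k) => IsIrreducible S ∧ S ⊆ Z) Z'

/-- The coordinate ring of the standard affine chart `{x_i = 1}` of the closed subscheme of `ℙ^k`
defined by the homogeneous ideal `I` (dehomogenization with respect to `x_i`). -/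
abbrev ChartRing {k : ℕ} (I : Ideal (CoordRing k)) (i : Fin (k + 1)) : Type :=
  CoordRing k ⧸ (I ⊔ Ideal.span {X i - 1})

/-- The point `x` lies on the closed subscheme of `ℙ^k` defined by the homogeneous ideal `I`, and
this scheme is smooth over `ℂ` at `x`: in some standard affine chart containing `x`, the maximal
ideal of `x = (x_0 / x_i, …, x_k / x_i)` belongs to the smooth locus. -/
def IsSmoothPoint {k : ℕ} (I : Ideal (CoordRing k)) (x : ProjSpace k) : Prop :=
  ∃ i : Fin (k + 1), x.rep i ≠ 0 ∧
    ∃ m : PrimeSpectrum (ChartRing I i),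
      m.asIdeal.comap (Ideal.Quotient.mk (I ⊔ Ideal.span {X i - 1})) =
          RingHom.ker (eval (fun c => x.rep c / x.rep i) : CoordRing k →+* ℂ) ∧
        m ∈ Algebra.smoothLocus ℂ (ChartRing I i)

/-- `φ` is regular on the locally closed set `A ⊆ ℙ^k`: locally on `A` it is given by homogeneous
polynomials of one degree without common zeros. -/
def IsRegularMapOn {k l : ℕ} (φ : ProjSpace k → ProjSpace l) (A : Set (ProjSpace k)) : Prop :=
  ∀ a ∈ A, ∃ W : Set (ProjSpace k), IsOpen W ∧ a ∈ W ∧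
    ∃ (d : ℕ) (F : Fin (l + 1) → CoordRing k), (∀ i, (F i).IsHomogeneous d) ∧
      ∀ x ∈ W ∩ A, ∃ hF : (fun i => eval x.rep (F i)) ≠ 0,
        φ x = Projectivization.mk ℂ (fun i => eval x.rep (F i)) hF

/-- `A` is a nonempty relatively open subset of `Z`. -/
def IsNonemptyOpenIn {k : ℕ} (A Z : Set (ProjSpace k)) : Prop :=
  A.Nonempty ∧ ∃ W : Set (ProjSpace k), IsOpen W ∧ A = W ∩ Z

/-- For a correspondence `Γ ⊆ ℙ^k × ℙ^l` with projections `π₁`, `π₂`, and irreducible closed sets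
`X'`, `Y'`: the composite `π₂ ∘ π₁⁻¹` is a birational map from `X'` to `Y'`. That is, there are
nonempty open `A ⊆ X'`, `B ⊆ Y'` such that every fibre `π₁⁻¹(x)`, `x ∈ A`, and every fibre
`π₂⁻¹(y)`, `y ∈ B`, is a single point, and the resulting maps `φ = π₂ ∘ π₁⁻¹ : A → B` and
`ψ = π₁ ∘ π₂⁻¹ : B → A` are regular and inverse to each other. -/
def IsBirationalVia {k l : ℕ} (Γ : Set (ProjSpace k × ProjSpace l))
    (X' : Set (ProjSpace k)) (Y' : Set (ProjSpace l)) : Prop :=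
  ∃ (A : Set (ProjSpace k)) (B : Set (ProjSpace l))
    (φ : ProjSpace k → ProjSpace l) (ψ : ProjSpace l → ProjSpace k),
    IsNonemptyOpenIn A X' ∧ IsNonemptyOpenIn B Y' ∧
    IsRegularMapOn φ A ∧ IsRegularMapOn ψ B ∧
    Set.MapsTo φ A B ∧ Set.MapsTo ψ B A ∧ Set.InvOn ψ φ A B ∧
    (∀ x ∈ A, ∀ y, (x, y) ∈ Γ ↔ y = φ x) ∧
    (∀ y ∈ B, ∀ x, (x, y) ∈ Γ ↔ x = ψ y)

/-- Matrices of `n` linear maps `ℂ^{k+1} → ℂ^{h_j+1}`. -/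
abbrev Cameras (k n : ℕ) (h : Fin n → ℕ) : Type :=
  ∀ j : Fin n, Matrix (Fin (h j + 1)) (Fin (k + 1)) ℂ

variable {k n : ℕ} {h : Fin n → ℕ}

/-- The matrices have maximal rank, so that they define projections of `ℙ^k` onto `ℙ^{h_j}`. -/
def AreProjections (P : Cameras k n h) : Prop :=
  ∀ j, (P j).rank = h j + 1

/-- The matrix `M` whose `j`-th block of rows is
`(P_j | 0 … 0 | Q_j(x) | 0 … 0)`, with `Q_j(x)` in the `j`-th of the last `n` columns. -/
def critMatrix (P Q : Cameras k n h) :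
    Matrix (Σ j : Fin n, Fin (h j + 1)) (Fin (k + 1) ⊕ Fin n) (CoordRing k) :=
  Matrix.of fun r c =>
    Sum.elim (fun b : Fin (k + 1) => C (P r.1 r.2 b))
      (fun l : Fin n => if l = r.1 then ∑ b, C (Q r.1 r.2 b) * X b else 0) c

/-- The ideal generated by the minors of order `k + n + 1` of `critMatrix P Q`. (A choice `e` of
rows with repetitions contributes a zero determinant.) -/
def critIdeal (P Q : Cameras k n h) : Ideal (CoordRing k) :=
  Ideal.span (Set.range fun e : (Fin (k + 1) ⊕ Fin n) → (Σ j : Fin n, Fin (h j + 1)) =>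
    ((critMatrix P Q).submatrix e id).det)

/-- The critical locus as a set of points, the zero locus of `critIdeal P Q`. The critical locus
`𝒳` is `critLocus P Q`, and `𝒴` is `critLocus Q P`. -/
def critLocus (P Q : Cameras k n h) : Set (ProjSpace k) :=
  {x | ∀ f ∈ critIdeal P Q, eval x.rep f = 0}

/-- The rank of `critMatrix P Q` at a point. -/
def critRank (P Q : Cameras k n h) (x : ProjSpace k) : ℕ :=
  ((critMatrix P Q).map (eval x.rep)).rank

/-- The unified critical locus. The condition `Q_j(x) = P_j(y)` is the vanishing of the `2 × 2`
minors of `(P_j(y) | Q_j(x))`. -/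
def unifiedLocus (P Q : Cameras k n h) : Set (ProjSpace k × ProjSpace k) :=
  {p | p.1 ∈ critLocus P Q ∧ p.2 ∈ critLocus Q P ∧
    ∀ j, ∀ a b : Fin (h j + 1),
      (Q j).mulVec p.1.rep a * (P j).mulVec p.2.rep b =
        (Q j).mulVec p.1.rep b * (P j).mulVec p.2.rep a}

end CriticalLoci

end

/-! ### Formal curves on formally smooth algebras -/

section FormalCurves

variable {K : Type*} [Field K]

/-! If every `Q_j(x)` is nonzero, then `(x, y)` lies in the unified locus exactly when `y` extends
to a vector `(y, u)` killed by the critical matrix at `x`: the scalars `-u_j` are the factors in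
`P_j(y) ~ Q_j(x)`. Where the kernel is moreover a line, the fibre is one point, given by cofactors
of the matrix, hence by forms (`exists_fibre_eq`). The situation is symmetric in `P` and `Q`, so it
suffices to find one point of the unified locus with both projections in such good open sets of the
right components (`isBirationalVia_of_mem`).

Smoothness supplies three things. The local ring is a domain, so a neighbourhood of the point lies
in a single component (`exists_nhds_subset_component`). The matrix has corank one: otherwise all
maximal minors vanish to second order, the tangent space is everything, and the critical locus is
the whole space, where the rank hypothesis takes over (`IsSmoothPoint.hasCofactor`). Finally,
tangent vectors extend to formal arcs.

The obstacle is that `x₀` may lie in the centre of some `Q_j`. Corank one makes this `j` unique and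
puts `x₀` on an arc with tangent `v`, `Q_j(v) = P_j(y₀)`. Along the arc all cameras become defined,
and the cofactor point tends to `y₀`. The Nullstellensatz turns the arc into an honest nearby point
(`exists_mem_unifiedLocus_isDefinedAt`). This is done once for `x₀` and once, with roles exchanged,
for the second point. -/

lemma IsAdicComplete.sq {R : Type*} [CommRing R] (I : Ideal R) [IsAdicComplete I R] :
    IsAdicComplete (I ^ 2) R where
  haus' x hx := by
    refine IsHausdorff.haus' (I := I) x fun n => ?_
    refine (hx n).mono ?_
    rw [← pow_mul]
    exact Submodule.smul_mono_left (Ideal.pow_le_pow_right (by lia))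
  prec' f hf := by
    have hle : ∀ n : ℕ, ((I ^ 2) ^ n • ⊤ : Submodule R R) ≤ (I ^ n • ⊤ : Submodule R R) := by
      intro n
      rw [← pow_mul]
      exact Submodule.smul_mono_left (Ideal.pow_le_pow_right (by lia))
    obtain ⟨L, hL⟩ := IsPrecomplete.prec' (I := I) f fun {m n} h => (hf h).mono (hle m)
    -- The `I`-adic limit is also the `I ^ 2`-adic one: congruence modulo `I ^ (2 * n)` is reached
    -- at index `2 * n`.
    refine ⟨L, fun n => (hf (show n ≤ 2 * n by lia)).trans ?_⟩
    rw [← pow_mul]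
    exact hL (2 * n)

/-- A first order arc on a formally smooth algebra extends to a formal arc. -/
lemma exists_powerSeries_lift {A : Type*} [CommRing A] [Algebra K A] [Algebra.FormallySmooth K A]
    (τ : A →ₐ[K] PowerSeries K ⧸ (Ideal.span {(PowerSeries.X : PowerSeries K)}) ^ 2) :
    ∃ θ : A →ₐ[K] PowerSeries K, (Ideal.Quotient.mkₐ K _).comp θ = τ := by
  have := IsAdicComplete.sq (Ideal.span {(PowerSeries.X : PowerSeries K)})
  exact Algebra.FormallySmooth.exists_mkₐ_comp_eq_of_isAdicComplete τ

/-- A point `e` and a derivation `δ` at `e` on a formally smooth algebra are the first two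
coefficients of a formal arc. -/
lemma exists_powerSeries_of_derivation {A : Type*} [CommRing A] [Algebra K A]
    [Algebra.FormallySmooth K A] (e : A →ₐ[K] K) (δ : A →ₗ[K] K)
    (hδ : ∀ a b, δ (a * b) = e a * δ b + e b * δ a) :
    ∃ θ : A →ₐ[K] PowerSeries K,
      ∀ a, PowerSeries.constantCoeff (θ a) = e a ∧ PowerSeries.coeff 1 (θ a) = δ a := by
  classical
  set I := Ideal.span {(PowerSeries.X : PowerSeries K)} ^ 2 with hI
  have hδ1 : δ 1 = 0 := by simpa using hδ 1 1
  let s : A → PowerSeries K := fun a => PowerSeries.C (e a) + PowerSeries.X * PowerSeries.C (δ a)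
  let τ : A →ₐ[K] PowerSeries K ⧸ I := AlgHom.ofLinearMap
    { toFun := fun a => Ideal.Quotient.mk I (s a)
      map_add' := fun a b => by
        rw [← map_add]; congr 1; simp only [s, map_add]; ring
      map_smul' := fun c a => by
        simp only [s, RingHom.id_apply, Algebra.smul_def c (Ideal.Quotient.mk I _)]
        rw [show algebraMap K (PowerSeries K ⧸ I) c = Ideal.Quotient.mk I (PowerSeries.C c) from rfl,
          ← map_mul]
        congr 1
        simp only [map_smul, smul_eq_mul, map_mul]; ring }
    (by
      change Ideal.Quotient.mk I (s 1) = 1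
      rw [← map_one (Ideal.Quotient.mk I)]; congr 1; simp [s, hδ1])
    (by
      intro a b
      change Ideal.Quotient.mk I (s (a * b)) = Ideal.Quotient.mk I (s a) * Ideal.Quotient.mk I (s b)
      rw [← map_mul, Ideal.Quotient.eq, hI, Ideal.span_singleton_pow, Ideal.mem_span_singleton]
      refine ⟨- PowerSeries.C (δ a) * PowerSeries.C (δ b), ?_⟩
      simp only [s, hδ, map_mul, map_add]; ring)
  obtain ⟨θ, hθ⟩ := exists_powerSeries_lift τ
  refine ⟨θ, fun a => ?_⟩
  have h := congr($hθ a)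
  change Ideal.Quotient.mk I (θ a) = Ideal.Quotient.mk I (s a) at h
  rw [Ideal.Quotient.eq, hI, Ideal.span_singleton_pow, Ideal.mem_span_singleton,
    PowerSeries.X_pow_dvd_iff] at h
  have h0 := h 0 (by norm_num)
  have h1 := h 1 (by norm_num)
  simp only [s, map_sub, map_add, sub_eq_zero] at h0 h1
  refine ⟨by simpa using h0, ?_⟩
  rw [h1]
  simp

lemma MvPolynomial.IsHomogeneous.eval_const_mul {σ R : Type*} [CommRing R] {p : MvPolynomial σ R}
    {r : ℕ} (hp : p.IsHomogeneous r) (c : R) (z : σ → R) :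
    eval (fun i => c * z i) p = c ^ r * eval z p := by
  rw [eval_eq, eval_eq, Finset.mul_sum]
  refine Finset.sum_congr rfl fun d hd => ?_
  have : ∑ i ∈ d.support, d i = r := by
    have := hp (mem_support_iff.mp hd)
    simpa [Finsupp.weight_apply, Finsupp.sum] using this
  simp_rw [mul_pow, Finset.prod_mul_distrib, Finset.prod_pow_eq_pow_sum, this]
  ring

lemma MvPolynomial.IsHomogeneous.aeval_const_mul {σ R T : Type*} [CommRing R] [CommRing T]
    [Algebra R T] {p : MvPolynomial σ R}
    {r : ℕ} (hp : p.IsHomogeneous r) (c : T) (z : σ → T) :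
    MvPolynomial.aeval (fun i => c * z i) p = c ^ r * MvPolynomial.aeval z p := by
  have := (hp.map (algebraMap R T)).eval_const_mul c z
  rwa [eval_map, eval_map] at this

lemma MvPolynomial.exists_eval_ne_zero {σ : Type*} [Infinite K] {p : MvPolynomial σ K}
    (hp : p ≠ 0) : ∃ x, eval x p ≠ 0 := by
  by_contra! h
  exact hp (funext fun x => by simpa using h x)

/-- The value of a form along an arc is governed by the tangent vector of the arc. -/
lemma coeff_eval_of_isHomogeneous {A ι : Type*} [CommRing A] (θ : A →+* PowerSeries K)
    {p : MvPolynomial ι A} {r : ℕ} (hp : p.IsHomogeneous r) (x : ι → A)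
    (hx : ∀ i, PowerSeries.constantCoeff (θ (x i)) = 0) :
    PowerSeries.coeff r (θ (eval x p)) =
      eval (fun i => PowerSeries.coeff 1 (θ (x i)))
        (map ((PowerSeries.constantCoeff (R := K)).comp θ) p) := by
  choose z hz using fun i => PowerSeries.X_dvd_iff.mpr (hx i)
  have h1 : θ (eval x p) = PowerSeries.X ^ r * eval z (map θ p) := by
    rw [← (hp.map θ).eval_const_mul, map_eval]
    exact congrArg (fun w => eval w (map θ p)) (_root_.funext hz)
  have h2 := PowerSeries.coeff_X_pow_mul (eval z (map θ p)) r 0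
  rw [zero_add] at h2
  rw [h1, h2, PowerSeries.coeff_zero_eq_constantCoeff_apply, map_eval, map_map]
  refine congrArg (fun w => eval w _) (_root_.funext fun i => ?_)
  rw [Function.comp_apply, hz, ← PowerSeries.coeff_zero_eq_constantCoeff_apply]
  exact (PowerSeries.coeff_succ_X_mul 0 (z i)).symm

/-! ### Integrality of formally smooth local algebras, by leading forms and arcs. -/

section LocalDomain

open IsLocalRing

lemma algHom_eq_zero_iff_mem_maximalIdeal {O : Type*} [CommRing O] [IsLocalRing O] [Algebra K O]
    (e : O →ₐ[K] K) (a : O) : e a = 0 ↔ a ∈ maximalIdeal O := by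
  have : RingHom.ker e = maximalIdeal O :=
    eq_maximalIdeal (RingHom.ker_isMaximal_of_surjective e fun c => ⟨algebraMap K O c, by simp⟩)
  rw [← this, RingHom.mem_ker]

variable {O : Type*} [CommRing O] [IsLocalRing O] [IsNoetherianRing O] [Algebra K O]

/-- A local algebra with a rational point has generators of its maximal ideal on which derivations
take arbitrary values. -/
lemma exists_generators_forall_exists_derivation (e : O →ₐ[K] K) :
    ∃ (ι : Type) (_ : Fintype ι) (x : ι → O), Ideal.span (Set.range x) = maximalIdeal O ∧
      ∀ v : ι → K, ∃ δ : O →ₗ[K] K, (∀ a b, δ (a * b) = e a * δ b + e b * δ a) ∧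
        ∀ i, δ (x i) = v i := by
  have hker := algHom_eq_zero_iff_mem_maximalIdeal e
  have hsub : ∀ a, a - algebraMap K O (e a) ∈ maximalIdeal O := fun a =>
    (hker _).mp (by simp)
  obtain ⟨d, y, hy⟩ := Submodule.fg_iff_exists_fin_generating_family.mp
    (IsNoetherian.noetherian (maximalIdeal O))
  let N : Submodule K O := (maximalIdeal O ^ 2).restrictScalars K
  have hN : ∀ a, N.mkQ a = 0 ↔ a ∈ maximalIdeal O ^ 2 := fun a => by
    rw [Submodule.mkQ_apply, Submodule.Quotient.mk_eq_zero]; rfl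
  -- A subfamily of the generators whose classes form a basis of the cotangent space `𝔪 / 𝔪²`; it
  -- still generates `𝔪` by Nakayama.
  obtain ⟨κ, s, hs, hspan, hli⟩ := exists_linearIndependent' K (N.mkQ ∘ y)
  have : Fintype κ := @Fintype.ofFinite κ (Finite.of_injective s hs)
  have hym : ∀ i, y i ∈ maximalIdeal O := fun i => hy ▸ Submodule.subset_span ⟨i, rfl⟩
  refine ⟨κ, this, y ∘ s, le_antisymm ?_ ?_, fun v => ?_⟩
  · rw [Ideal.span_le]
    rintro _ ⟨i, rfl⟩
    exact hym _
  · refine Submodule.le_of_le_smul_of_le_jacobson_bot (I := maximalIdeal O)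
      (IsNoetherian.noetherian (maximalIdeal O)) (jacobson_eq_maximalIdeal ⊥ bot_ne_top).ge ?_
    have h1 : ∀ z ∈ Submodule.span K (Set.range (N.mkQ ∘ y ∘ s)), ∀ a : O, N.mkQ a = z →
        a ∈ Ideal.span (Set.range (y ∘ s)) ⊔ maximalIdeal O • maximalIdeal O := by
      intro z hz
      have hle : Submodule.span K (Set.range (N.mkQ ∘ y ∘ s)) ≤
          ((Ideal.span (Set.range (y ∘ s))).restrictScalars K).map N.mkQ := by
        rw [Submodule.span_le]
        rintro _ ⟨i, rfl⟩
        exact ⟨y (s i), Ideal.subset_span ⟨i, rfl⟩, rfl⟩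
      obtain ⟨b, hb, rfl⟩ := hle hz
      intro a ha
      have : a - b ∈ maximalIdeal O ^ 2 := (hN _).mp (by rw [map_sub, ha, sub_self])
      rw [show a = b + (a - b) by ring, smul_eq_mul, ← sq]
      exact Submodule.add_mem_sup hb this
    have h2 : ∀ i, y i ∈ Ideal.span (Set.range (y ∘ s)) ⊔ maximalIdeal O • maximalIdeal O :=
      fun i => h1 _ (by
        have : (N.mkQ ∘ y) i ∈ Submodule.span K (Set.range (N.mkQ ∘ y)) :=
          Submodule.subset_span ⟨i, rfl⟩
        rwa [← hspan] at this) _ rfl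
    conv_lhs => rw [← hy]
    rw [Submodule.span_le]
    rintro _ ⟨i, rfl⟩
    exact h2 i
  · obtain ⟨φ, hφ⟩ : ∃ φ : (O ⧸ N) →ₗ[K] K, ∀ i, φ (N.mkQ (y (s i))) = v i := by
      obtain ⟨φ, hφ⟩ := LinearMap.exists_extend ((Module.Basis.span hli).constr K v)
      refine ⟨φ, fun i => ?_⟩
      have h3 := congr($hφ (Module.Basis.span hli i))
      rw [Module.Basis.constr_basis] at h3
      rw [← h3]
      simp [Module.Basis.span_apply]
    let D : O →ₗ[K] O := LinearMap.id - (Algebra.linearMap K O).comp e.toLinearMap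
    -- `D` is the projection of `O = K ⊕ 𝔪` onto `𝔪`. The Leibniz rule for `φ ∘ D` holds because the
    -- extra term `D a * D b` dies in `O / 𝔪²`.
    have hD : ∀ a, D a = a - algebraMap K O (e a) := fun a => rfl
    refine ⟨φ ∘ₗ N.mkQ ∘ₗ D, fun a b => ?_, fun i => ?_⟩
    · have h4 : D (a * b) = e a • D b + e b • D a + D a * D b := by
        simp only [hD, map_mul, Algebra.smul_def]; ring
      have h5 : N.mkQ (D a * D b) = 0 := by
        rw [hN, sq]
        exact Ideal.mul_mem_mul (hsub a) (hsub b)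
      simp [LinearMap.comp_apply, h4, h5, map_add, map_smul, -Submodule.mkQ_apply]
    · have : D (y (s i)) = y (s i) := by rw [hD, (hker _).mpr (hym _), map_zero, sub_zero]
      simp only [LinearMap.comp_apply, Function.comp_apply, this, hφ]

/-- A formally smooth Noetherian local algebra with a rational point over an infinite field is a
domain. -/
lemma isDomain_of_formallySmooth [Infinite K] [Algebra.FormallySmooth K O] (e : O →ₐ[K] K) :
    IsDomain O := by
  have hker := algHom_eq_zero_iff_mem_maximalIdeal e
  obtain ⟨ι, _, x, hx, hδ⟩ := exists_generators_forall_exists_derivation e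
  have hxm : ∀ i, x i ∈ maximalIdeal O := fun i => hx ▸ Ideal.subset_span ⟨i, rfl⟩
  have key : ∀ f : O, f ≠ 0 → ∃ F : MvPolynomial ι K, F ≠ 0 ∧
      ∀ (θ : O →ₐ[K] PowerSeries K), (∀ a, PowerSeries.constantCoeff (θ a) = e a) →
        eval (fun i => PowerSeries.coeff 1 (θ (x i))) F ≠ 0 → θ f ≠ 0 := by
    intro f hf
    -- The `𝔪`-adic order of `f`, finite by Krull's intersection theorem. The form `F` is the
    -- leading form of `f`; it is nonzero since otherwise `f` would lie in `𝔪 ^ (r + 1)`.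
    obtain ⟨r, hr, hr'⟩ : ∃ r, f ∈ maximalIdeal O ^ r ∧ f ∉ maximalIdeal O ^ (r + 1) := by
      by_contra! h
      have : ∀ r, f ∈ maximalIdeal O ^ r := fun r => by
        induction r with
        | zero => simp
        | succ r ih => exact h r ih
      have h2 := Ideal.iInf_pow_eq_bot_of_isLocalRing (maximalIdeal O) (Ideal.IsPrime.ne_top')
      exact hf (by simpa [h2] using Ideal.mem_iInf.mpr this)
    rw [← hx, Ideal.mem_span_pow_iff_exists_isHomogeneous] at hr
    obtain ⟨p, hp, rfl⟩ := hr
    refine ⟨map (e : O →+* K) p, fun h0 => hr' ?_, fun θ hθ hne h0 => hne ?_⟩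
    · rw [eval_eq]
      refine Ideal.sum_mem _ fun d hd => ?_
      rw [pow_succ']
      refine Ideal.mul_mem_mul ((hker _).mp ?_) ?_
      · have := congr(coeff d $h0)
        rwa [coeff_map, coeff_zero] at this
      · have hd' : ∑ i ∈ d.support, d i = r := by
          have := hp (mem_support_iff.mp hd)
          simpa [Finsupp.weight_apply, Finsupp.sum] using this
        rw [← hd', ← Finset.prod_pow_eq_pow_sum]
        exact Ideal.prod_mem_prod fun i _ => Ideal.pow_mem_pow (hxm i) _
    · have h := coeff_eval_of_isHomogeneous (θ : O →+* PowerSeries K) hp x fun i => by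
        simpa using (hθ (x i)).trans ((hker _).mpr (hxm i))
      have h2 : (PowerSeries.constantCoeff (R := K)).comp (θ : O →+* PowerSeries K) = e := by
        ext a; simpa using hθ a
      rw [h2] at h
      rw [RingHom.coe_coe] at h
      exact h.symm.trans (by rw [h0, map_zero])
  have : NoZeroDivisors O := by
    refine ⟨fun {f g} hfg => ?_⟩
    by_contra! hne
    obtain ⟨F, hF, hF'⟩ := key f hne.1
    obtain ⟨G, hG, hG'⟩ := key g hne.2
    -- A tangent direction in which neither leading form vanishes: along an arc in this direction
    -- both `f` and `g` are nonzero power series, and so is their product.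
    obtain ⟨v, hv⟩ := exists_eval_ne_zero (mul_ne_zero hF hG)
    obtain ⟨δ, hδ1, hδ2⟩ := hδ v
    obtain ⟨θ, hθ⟩ := exists_powerSeries_of_derivation e δ hδ1
    have hv2 : (fun i => PowerSeries.coeff 1 (θ (x i))) = v := by
      ext i; rw [(hθ _).2, hδ2]
    rw [map_mul] at hv
    have h1 := hF' θ (fun a => (hθ a).1) (by rw [hv2]; exact left_ne_zero_of_mul hv)
    have h2 := hG' θ (fun a => (hθ a).1) (by rw [hv2]; exact right_ne_zero_of_mul hv)
    exact mul_ne_zero h1 h2 (by rw [← map_mul, hfg, map_zero])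
  exact NoZeroDivisors.to_isDomain O

end LocalDomain

end FormalCurves

namespace CriticalLoci

/-! ### Smooth points in affine charts -/

section Charts

variable {k : ℕ} {I : Ideal (CoordRing k)} {i : Fin (k + 1)} {a : Fin (k + 1) → ℂ}

/-- The scheme defined by `I` is smooth at the point `a` of the chart `{x_i = 1}`. -/
def IsSmoothAtVec (I : Ideal (CoordRing k)) (i : Fin (k + 1)) (a : Fin (k + 1) → ℂ) : Prop :=
  ∃ m : PrimeSpectrum (ChartRing I i),
    m.asIdeal.comap (Ideal.Quotient.mk (I ⊔ Ideal.span {X i - 1})) =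
        RingHom.ker (eval a : CoordRing k →+* ℂ) ∧
      m ∈ Algebra.smoothLocus ℂ (ChartRing I i)

lemma eval_eq_zero_of_comap_eq {m : PrimeSpectrum (ChartRing I i)}
    (hm : m.asIdeal.comap (Ideal.Quotient.mk (I ⊔ Ideal.span {X i - 1})) =
        RingHom.ker (eval a : CoordRing k →+* ℂ)) :
    ∀ f ∈ I ⊔ Ideal.span {X i - 1}, eval a f = 0 := by
  intro f hf
  rw [← RingHom.mem_ker, ← hm, Ideal.mem_comap, Ideal.Quotient.eq_zero_iff_mem.mpr hf]
  exact zero_mem _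

/-- An algebra map out of the chart ring extends to the local ring at `m` as soon as it has the
point `m` as residue. -/
lemma exists_localization_lift {m : PrimeSpectrum (ChartRing I i)}
    (hm : m.asIdeal.comap (Ideal.Quotient.mk (I ⊔ Ideal.span {X i - 1})) =
        RingHom.ker (eval a : CoordRing k →+* ℂ))
    {T : Type*} [CommRing T] [Algebra ℂ T] (τ : CoordRing k →ₐ[ℂ] T)
    (h0 : ∀ f ∈ I ⊔ Ideal.span {X i - 1}, τ f = 0)
    (hu : ∀ f, eval a f ≠ 0 → IsUnit (τ f)) :
    ∃ τ' : Localization.AtPrime m.asIdeal →ₐ[ℂ] T,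
      ∀ f, τ' (algebraMap (ChartRing I i) _ (Ideal.Quotient.mk _ f)) = τ f := by
  let σ : ChartRing I i →ₐ[ℂ] T := Ideal.Quotient.liftₐ _ τ h0
  have hσ : ∀ f, σ (Ideal.Quotient.mk _ f) = τ f := fun f => rfl
  have hunit : ∀ y : m.asIdeal.primeCompl, IsUnit (σ y) := by
    rintro ⟨y, hy⟩
    obtain ⟨f, rfl⟩ := Ideal.Quotient.mk_surjective y
    refine hu f fun hf => hy ?_
    rw [← RingHom.mem_ker, ← hm] at hf
    exact hf
  refine ⟨IsLocalization.liftAlgHom (M := m.asIdeal.primeCompl) hunit, fun f => ?_⟩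
  rw [IsLocalization.liftAlgHom_apply, IsLocalization.lift_eq]
  exact hσ f

lemma isUnit_quotient_of_constantCoeff_ne_zero {K : Type*} [Field K] (J : Ideal (PowerSeries K))
    (g : PowerSeries K) (hg : PowerSeries.constantCoeff g ≠ 0) : IsUnit (Ideal.Quotient.mk J g) :=
  (PowerSeries.isUnit_iff_constantCoeff.mpr (isUnit_iff_ne_zero.mpr hg)).map _

lemma constantCoeff_aeval {σ : Type*} (γ : σ → PowerSeries ℂ) (f : MvPolynomial σ ℂ) :
    PowerSeries.constantCoeff (aeval γ f) =
      eval (fun c => PowerSeries.constantCoeff (γ c)) f := by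
  induction f using MvPolynomial.induction_on with
  | C c => simp
  | add p q hp hq => simp [hp, hq]
  | mul_X p c hp => simp [hp]

lemma eval_aeval (y : Fin (k + 1) → ℂ) {σ : Type*} (g : σ → CoordRing k) (f : MvPolynomial σ ℂ) :
    eval y (aeval g f) = eval (fun c => eval y (g c)) f := by
  induction f using MvPolynomial.induction_on with
  | C c => simp
  | add p q hp hq => rw [map_add, map_add, hp, hq, map_add]
  | mul_X p c hp => rw [map_mul, map_mul, hp, map_mul, aeval_X, eval_X]

/-- Through a smooth point there is a formal arc of the scheme in every tangent direction. -/
lemma IsSmoothAtVec.exists_curve (hs : IsSmoothAtVec I i a) (v : Fin (k + 1) → ℂ) (hvi : v i = 0)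
    (hv : ∀ f ∈ I, PowerSeries.X ^ 2 ∣
      aeval (fun c => PowerSeries.C (a c) + PowerSeries.X * PowerSeries.C (v c)) f) :
    ∃ γ : Fin (k + 1) → PowerSeries ℂ,
      (∀ c, PowerSeries.X ^ 2 ∣ γ c - (PowerSeries.C (a c) + PowerSeries.X * PowerSeries.C (v c))) ∧
      γ i = 1 ∧ ∀ f ∈ I, aeval γ f = 0 := by
  obtain ⟨m, hm, hsm⟩ := hs
  set J := I ⊔ Ideal.span {X i - 1} with hJ
  have hai : a i = 1 := by
    have := eval_eq_zero_of_comap_eq hm (X i - 1)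
      (Ideal.mem_sup_right (Ideal.subset_span rfl))
    simpa [sub_eq_zero] using this
  set N := Ideal.span {(PowerSeries.X : PowerSeries ℂ)} ^ 2 with hN
  set ℓ : Fin (k + 1) → PowerSeries ℂ :=
    fun c => PowerSeries.C (a c) + PowerSeries.X * PowerSeries.C (v c) with hℓ
  have hmem : ∀ g, g ∈ N ↔ PowerSeries.X ^ 2 ∣ g := fun g => by
    rw [hN, Ideal.span_singleton_pow, Ideal.mem_span_singleton]
  have hℓ0 : (fun c => PowerSeries.constantCoeff (ℓ c)) = a := by ext c; simp [hℓ]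
  have hsmooth : Algebra.FormallySmooth ℂ (Localization.AtPrime m.asIdeal) := hsm
  obtain ⟨τ', hτ'⟩ := exists_localization_lift hm ((Ideal.Quotient.mkₐ ℂ N).comp (aeval ℓ))
    (by
      have hle : J ≤ RingHom.ker ((Ideal.Quotient.mkₐ ℂ N).comp (aeval ℓ)) := by
        refine sup_le (fun f hf => ?_) ?_
        · exact Ideal.Quotient.eq_zero_iff_mem.mpr ((hmem _).mpr (hv f hf))
        · rw [Ideal.span_le, Set.singleton_subset_iff]
          change Ideal.Quotient.mk N (aeval ℓ (X i - 1)) = 0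
          simp [hℓ, hai, hvi]
      exact fun f hf => hle hf)
    (fun f hf => isUnit_quotient_of_constantCoeff_ne_zero _ _ (by
      rwa [RingHom.coe_coe, constantCoeff_aeval, hℓ0]))
  obtain ⟨θ, hθ⟩ := exists_powerSeries_lift (K := ℂ) (A := Localization.AtPrime m.asIdeal) τ'
  let ρ : CoordRing k →ₐ[ℂ] PowerSeries ℂ :=
    (θ.comp (IsScalarTower.toAlgHom ℂ (ChartRing I i) _)).comp (Ideal.Quotient.mkₐ ℂ _)
  have hρ : ∀ f, ρ f = θ (algebraMap (ChartRing I i) _ (Ideal.Quotient.mk _ f)) := fun f => rfl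
  have hρJ : ∀ f ∈ J, ρ f = 0 := fun f hf => by
    rw [hρ, Ideal.Quotient.eq_zero_iff_mem.mpr hf, map_zero, map_zero]
  have hργ : ∀ f, aeval (fun c => ρ (X c)) f = ρ f := fun f => by
    exact congr($((aeval_unique ρ).symm) f)
  refine ⟨fun c => ρ (X c), fun c => ?_, ?_, fun f hf => ?_⟩
  · rw [← hmem, ← Ideal.Quotient.eq]
    have h1 := congr($hθ (algebraMap (ChartRing I i) _ (Ideal.Quotient.mk _ (X c))))
    rw [hτ'] at h1
    have h2 : (Ideal.Quotient.mkₐ ℂ N).comp (aeval ℓ) (X c) = Ideal.Quotient.mk N (ℓ c) := by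
      simp
    exact h1.trans h2
  · have := hρJ (X i - 1) (Ideal.mem_sup_right (Ideal.subset_span rfl))
    rwa [map_sub, map_one, sub_eq_zero] at this
  · rw [hργ]
    exact hρJ f (Ideal.mem_sup_left hf)

/-- Near a smooth point the scheme is integral. -/
lemma IsSmoothAtVec.exists_prime (hs : IsSmoothAtVec I i a) :
    ∃ p : Ideal (CoordRing k), p.IsPrime ∧ I ≤ p ∧ X i - 1 ∈ p ∧ (∀ f ∈ p, eval a f = 0) ∧
      ∃ g, eval a g ≠ 0 ∧ ∀ f ∈ p, g * f ∈ I ⊔ Ideal.span {X i - 1} := by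
  obtain ⟨m, hm, hsm⟩ := hs
  set J := I ⊔ Ideal.span {X i - 1} with hJ
  have hsmooth : Algebra.FormallySmooth ℂ (Localization.AtPrime m.asIdeal) := hsm
  obtain ⟨e, he⟩ := exists_localization_lift hm (aeval a)
    (fun f hf => by simpa using! eval_eq_zero_of_comap_eq hm f hf)
    (fun f hf => isUnit_iff_ne_zero.mpr (by simpa using! hf))
  have : IsNoetherianRing (Localization.AtPrime m.asIdeal) :=
    IsLocalization.isNoetherianRing m.asIdeal.primeCompl _ inferInstance
  have := isDomain_of_formallySmooth (K := ℂ) (O := Localization.AtPrime m.asIdeal) e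
  let ρ : CoordRing k →+* Localization.AtPrime m.asIdeal :=
    (algebraMap (ChartRing I i) _).comp (Ideal.Quotient.mk _)
  have hρ : ∀ f, ρ f = algebraMap (ChartRing I i) _ (Ideal.Quotient.mk _ f) := fun f => rfl
  have hJρ : ∀ f ∈ J, ρ f = 0 := fun f hf => by
    rw [hρ, Ideal.Quotient.eq_zero_iff_mem.mpr hf, map_zero]
  have hloc : ∀ f, ρ f = 0 → ∃ g, eval a g ≠ 0 ∧ g * f ∈ J := by
    intro f hf
    rw [hρ, IsLocalization.map_eq_zero_iff m.asIdeal.primeCompl] at hf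
    obtain ⟨⟨y, hy⟩, hyf⟩ := hf
    obtain ⟨g, rfl⟩ := Ideal.Quotient.mk_surjective y
    refine ⟨g, fun hg => hy ?_, ?_⟩
    · rw [← RingHom.mem_ker, ← hm] at hg
      exact hg
    · rw [← Ideal.Quotient.eq_zero_iff_mem, map_mul]
      exact hyf
  refine ⟨RingHom.ker ρ, RingHom.ker_isPrime ρ, fun f hf => hJρ f (Ideal.mem_sup_left hf),
    hJρ _ (Ideal.mem_sup_right (Ideal.subset_span rfl)), fun f hf => ?_, ?_⟩
  · have := he f
    rw [← hρ, RingHom.mem_ker.mp hf, map_zero] at this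
    simpa using! this.symm
  -- The kernel is finitely generated, so one product of denominators works for all its elements.
  · obtain ⟨S, hS⟩ := (IsNoetherian.noetherian (RingHom.ker ρ) : (RingHom.ker ρ).FG)
    have hS0 : ∀ f : S, ρ f = 0 := fun f => by
      rw [← RingHom.mem_ker, ← hS]; exact Submodule.subset_span f.2
    choose g hg hgf using fun f : S => hloc f (hS0 f)
    refine ⟨∏ f : S, g f, by rw [map_prod]; exact Finset.prod_ne_zero_iff.mpr fun f _ => hg f, ?_⟩
    have hle : RingHom.ker ρ ≤ Submodule.comap (LinearMap.mulLeft (CoordRing k) (∏ f : S, g f)) J := by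
      rw [← hS]
      refine Submodule.span_le.mpr fun f hf => ?_
      change (∏ f : S, g f) * f ∈ J
      rw [Finset.prod_eq_prod_sdiff_singleton_mul (Finset.mem_univ (⟨f, hf⟩ : S)), mul_assoc]
      exact J.mul_mem_left _ (hgf ⟨f, hf⟩)
    exact fun f hf => hle hf

/-- Smoothness is an open condition on the points of a scheme. -/
lemma IsSmoothAtVec.exists_open (hs : IsSmoothAtVec I i a) :
    ∃ g, eval a g ≠ 0 ∧ ∀ b : Fin (k + 1) → ℂ, b i = 1 → (∀ f ∈ I, eval b f = 0) →
      eval b g ≠ 0 → IsSmoothAtVec I i b := by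
  obtain ⟨m, hm, hsm⟩ := hs
  have : Algebra.FinitePresentation ℂ (ChartRing I i) :=
    Algebra.FinitePresentation.of_finiteType.mp inferInstance
  have hopen := Algebra.isOpen_smoothLocus (R := ℂ) (A := ChartRing I i)
  obtain ⟨_, ⟨_, ⟨f, rfl⟩, rfl⟩, hmf, hf⟩ :=
    PrimeSpectrum.isBasis_basic_opens.exists_subset_of_mem_open hsm hopen
  obtain ⟨g, rfl⟩ := Ideal.Quotient.mk_surjective f
  refine ⟨g, fun hg => hmf ?_, fun b hbi hb hbg => ?_⟩
  · rw [← RingHom.mem_ker, ← hm] at hg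
    exact hg
  · have hJ : ∀ f ∈ I ⊔ Ideal.span {X i - 1}, eval b f = 0 := by
      have : I ⊔ Ideal.span {X i - 1} ≤ RingHom.ker (eval b) := by
        refine sup_le hb ?_
        rw [Ideal.span_le, Set.singleton_subset_iff]
        simp [hbi]
      exact fun f hf => this hf
    let σ : ChartRing I i →+* ℂ := Ideal.Quotient.lift _ (eval b) hJ
    let mb : PrimeSpectrum (ChartRing I i) := ⟨RingHom.ker σ, RingHom.ker_isPrime σ⟩
    refine ⟨mb, ?_, hf fun h => hbg ?_⟩
    · ext f
      rfl
    · exact h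

/-- The first coefficient of a polynomial along an arc through the origin. -/
lemma coeff_aeval_X_mul {σ : Type*} (g : MvPolynomial σ ℂ) (r : ℕ)
    (hr : ∀ d < r, homogeneousComponent d g = 0) (z : σ → PowerSeries ℂ) :
    PowerSeries.coeff r (aeval (fun c => PowerSeries.X * z c) g) =
      eval (fun c => PowerSeries.constantCoeff (z c)) (homogeneousComponent r g) := by
  have hcoeff : ∀ d, PowerSeries.coeff r (aeval (fun c => PowerSeries.X * z c)
      (homogeneousComponent d g)) = if d = r then
        eval (fun c => PowerSeries.constantCoeff (z c)) (homogeneousComponent r g) else 0 := by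
    intro d
    rcases lt_trichotomy d r with hd | rfl | hd
    · simp [hr d hd, hd.ne]
    · rw [(homogeneousComponent_isHomogeneous d g).aeval_const_mul, if_pos rfl]
      have h2 := PowerSeries.coeff_X_pow_mul (aeval z (homogeneousComponent d g)) d 0
      rw [zero_add] at h2
      rw [h2, PowerSeries.coeff_zero_eq_constantCoeff_apply]
      exact constantCoeff_aeval _ _
    · rw [(homogeneousComponent_isHomogeneous d g).aeval_const_mul, if_neg hd.ne']
      exact PowerSeries.X_pow_dvd_iff.mp (dvd_mul_right _ _) _ hd
  have hsum : ∑ d ∈ Finset.range (max r g.totalDegree + 1), homogeneousComponent d g = g := by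
    conv_rhs => rw [← sum_homogeneousComponent g]
    refine (Finset.sum_subset (Finset.range_subset_range.mpr (by lia)) fun d _ hd => ?_).symm
    exact homogeneousComponent_eq_zero _ _ (by simpa using hd)
  conv_lhs => rw [← hsum]
  simp only [map_sum, hcoeff, Finset.sum_ite_eq', Finset.mem_range]
  rw [if_pos (by lia)]

/-- A scheme that is smooth at a point where its tangent space is that of the ambient space
contains the whole chart. -/
lemma IsSmoothAtVec.eval_eq_zero_of_forall_tangent (hs : IsSmoothAtVec I i a)
    (ht : ∀ v : Fin (k + 1) → ℂ, ∀ f ∈ I, PowerSeries.X ^ 2 ∣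
      aeval (fun c => PowerSeries.C (a c) + PowerSeries.X * PowerSeries.C (v c)) f)
    {f : CoordRing k} (hf : f ∈ I) (x : Fin (k + 1) → ℂ) (hx : x i = 1) : eval x f = 0 := by
  by_contra hne
  -- `f` restricted to the chart and recentred at `a`; it does not involve `X i`.
  let g : CoordRing k := aeval (fun c => if c = i then 1 else X c + C (a c)) f
  have hgx : eval (fun c => x c - a c) g = eval x f := by
    have h : (fun c => eval (fun c => x c - a c)
        (if c = i then 1 else X c + C (a c) : CoordRing k)) = x := by
      ext c
      by_cases hc : c = i
      · simp [hc, hx]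
      · simp [hc]
    rw [eval_aeval, h]
  have hg : g ≠ 0 := fun h => hne (by rw [← hgx, h, map_zero])
  have hex : ∃ r, homogeneousComponent r g ≠ 0 := by
    by_contra! h
    exact hg (by rw [← sum_homogeneousComponent g]; exact Finset.sum_eq_zero fun d _ => h d)
  classical
  let r := Nat.find hex
  obtain ⟨s, hsr⟩ := exists_eval_ne_zero (Nat.find_spec hex)
  obtain ⟨γ, hγ, hγi, hγI⟩ := hs.exists_curve (Function.update s i 0) (by simp) (ht _)
  choose w hw using hγ
  -- Off the coordinate `i` this is `(γ - a) / X`. The entry at `i` is irrelevant to `g` and is set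
  -- to `s i`, so that the constant terms are exactly `s`. The coefficient of degree `r` of `f`
  -- along the arc is then the lowest form of `g` at `s`, which is nonzero.
  let z : Fin (k + 1) → PowerSeries ℂ := fun c => PowerSeries.C (s c) +
    if c = i then 0 else PowerSeries.X * w c
  have hz : (fun c => PowerSeries.constantCoeff (z c)) = s := by
    ext c; simp only [z]; split_ifs <;> simp
  have h1 := coeff_aeval_X_mul g r (fun d hd => by simpa using Nat.find_min hex hd) z
  rw [hz] at h1
  have h2 : aeval (fun c => PowerSeries.X * z c) g = aeval γ f := by
    change aeval _ (aeval _ f) = _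
    have h : (fun c => aeval (fun c => PowerSeries.X * z c)
        (if c = i then 1 else X c + C (a c) : CoordRing k)) = γ := by
      ext1 c
      by_cases hc : c = i
      · simp [hc, hγi]
      · have := hw c
        rw [sub_eq_iff_eq_add] at this
        rw [this]
        simp [hc, z]
        ring
    rw [comp_aeval_apply, h]
  rw [h2, hγI f hf, map_zero] at h1
  exact hsr h1.symm

/-- Homogenization with respect to `x_i`. -/
lemma exists_homogenization (i : Fin (k + 1)) (f : CoordRing k) :
    ∃ (d : ℕ) (G : CoordRing k), G.IsHomogeneous d ∧ ∀ x : Fin (k + 1) → ℂ, x i ≠ 0 →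
      eval x G = x i ^ d * eval (fun c => x c / x i) f := by
  refine ⟨f.totalDegree, ∑ d ∈ Finset.range (f.totalDegree + 1),
    X i ^ (f.totalDegree - d) * homogeneousComponent d f, ?_, fun x hx => ?_⟩
  · refine IsHomogeneous.sum _ _ _ fun d hd => ?_
    have := (isHomogeneous_X_pow (R := ℂ) i (f.totalDegree - d)).mul
      (homogeneousComponent_isHomogeneous d f)
    rwa [Nat.sub_add_cancel (by simpa [Nat.lt_succ_iff] using hd)] at this
  · have hsum := congrArg (eval fun c => x c / x i) (sum_homogeneousComponent f)
    rw [← hsum, map_sum, map_sum, Finset.mul_sum]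
    refine Finset.sum_congr rfl fun d hd => ?_
    have hd' : d ≤ f.totalDegree := by simpa [Nat.lt_succ_iff] using hd
    have := (homogeneousComponent_isHomogeneous d f).eval_const_mul (x i)⁻¹ x
    simp_rw [div_eq_inv_mul]
    rw [this, map_mul, map_pow, eval_X, ← mul_assoc]
    congr 1
    rw [inv_pow, eq_mul_inv_iff_mul_eq₀ (pow_ne_zero _ hx), ← pow_add, Nat.sub_add_cancel hd']

end Charts

/-! ### The Zariski topology and components through smooth points -/

section Zariski

variable {k : ℕ}

lemma exists_rep_mk_eq (v : Fin (k + 1) → ℂ) (hv : v ≠ 0) :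
    ∃ c : ℂ, c ≠ 0 ∧ (Projectivization.mk ℂ v hv).rep = fun i => c * v i := by
  obtain ⟨c, hc⟩ := Projectivization.exists_smul_eq_mk_rep ℂ v hv
  refine ⟨c, c.ne_zero, ?_⟩
  rw [← hc]
  rfl

lemma eval_rep_mk_ne_zero_iff {f : CoordRing k} {d : ℕ} (hf : f.IsHomogeneous d)
    (v : Fin (k + 1) → ℂ) (hv : v ≠ 0) :
    eval (Projectivization.mk ℂ v hv).rep f ≠ 0 ↔ eval v f ≠ 0 := by
  obtain ⟨c, hc, h⟩ := exists_rep_mk_eq v hv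
  rw [h, hf.eval_const_mul]
  simp [hc]

lemma isOpen_setOf_eval_ne_zero {f : CoordRing k} {d : ℕ} (hf : f.IsHomogeneous d) :
    IsOpen {x : ProjSpace k | eval x.rep f ≠ 0} :=
  TopologicalSpace.isOpen_generateFrom_of_mem ⟨d, f, hf, rfl⟩

lemma exists_eval_ne_zero_subset {U : Set (ProjSpace k)} (hU : IsOpen U) {x : ProjSpace k}
    (hx : x ∈ U) : ∃ (d : ℕ) (f : CoordRing k), f.IsHomogeneous d ∧ eval x.rep f ≠ 0 ∧
      ∀ y : ProjSpace k, eval y.rep f ≠ 0 → y ∈ U := by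
  induction hU generalizing x with
  | basic s hs =>
    obtain ⟨d, f, hf, rfl⟩ := hs
    exact ⟨d, f, hf, hx, fun y hy => hy⟩
  | univ => exact ⟨0, 1, isHomogeneous_one _ _, by simp, fun _ _ => trivial⟩
  | inter s t _ _ ihs iht =>
    obtain ⟨d, f, hf, hfx, hfs⟩ := ihs hx.1
    obtain ⟨d', g, hg, hgx, hgt⟩ := iht hx.2
    refine ⟨_, f * g, hf.mul hg, by simp [hfx, hgx], fun y hy => ?_⟩
    rw [map_mul] at hy
    exact ⟨hfs y (left_ne_zero_of_mul hy), hgt y (right_ne_zero_of_mul hy)⟩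
  | sUnion S _ ih =>
    obtain ⟨s, hs, hxs⟩ := hx
    obtain ⟨d, f, hf, hfx, hfs⟩ := ih s hs hxs
    exact ⟨d, f, hf, hfx, fun y hy => ⟨s, hs, hfs y hy⟩⟩

/-- The ideal is generated by forms. -/
def IsConeIdeal (I : Ideal (CoordRing k)) : Prop :=
  ∃ S : Set (CoordRing k), (∀ f ∈ S, ∃ d, f.IsHomogeneous d) ∧ I = Ideal.span S

/-- The points of the closed subscheme of projective space defined by an ideal. -/
def projZeroLocus (I : Ideal (CoordRing k)) : Set (ProjSpace k) :=
  {x | ∀ f ∈ I, eval x.rep f = 0}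

variable {I : Ideal (CoordRing k)}

lemma IsConeIdeal.eval_const_mul (hI : IsConeIdeal I) {v : Fin (k + 1) → ℂ}
    (hv : ∀ f ∈ I, eval v f = 0) (c : ℂ) : ∀ f ∈ I, eval (fun i => c * v i) f = 0 := by
  obtain ⟨S, hS, rfl⟩ := hI
  have hle : Ideal.span S ≤ RingHom.ker (eval (fun i => c * v i)) := by
    refine Ideal.span_le.mpr fun f hf => ?_
    obtain ⟨d, hd⟩ := hS f hf
    change eval _ f = 0
    rw [hd.eval_const_mul, hv f (Ideal.subset_span hf), mul_zero]
  exact fun f hf => hle hf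

lemma IsConeIdeal.mk_mem_projZeroLocus (hI : IsConeIdeal I) {v : Fin (k + 1) → ℂ} (hv0 : v ≠ 0)
    (hv : ∀ f ∈ I, eval v f = 0) : Projectivization.mk ℂ v hv0 ∈ projZeroLocus I := by
  obtain ⟨c, -, h⟩ := exists_rep_mk_eq v hv0
  intro f hf
  rw [h]
  exact hI.eval_const_mul hv c f hf

lemma IsConeIdeal.isClosed_projZeroLocus (hI : IsConeIdeal I) : IsClosed (projZeroLocus I) := by
  obtain ⟨S, hS, rfl⟩ := hI
  have : projZeroLocus (Ideal.span S) = ⋂ f ∈ S, {x : ProjSpace k | eval x.rep f ≠ 0}ᶜ := by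
    ext x
    simp only [projZeroLocus, Set.mem_ofPred_eq, Set.mem_iInter, Set.mem_compl_iff, not_not]
    refine ⟨fun h f hf => h f (Ideal.subset_span hf), fun h f hf => ?_⟩
    have hle : Ideal.span S ≤ RingHom.ker (eval x.rep) := Ideal.span_le.mpr h
    exact hle hf
  rw [this]
  refine isClosed_biInter fun f hf => ?_
  obtain ⟨d, hd⟩ := hS f hf
  exact (isOpen_setOf_eval_ne_zero hd).isClosed_compl

lemma isSmoothPoint_iff {x : ProjSpace k} : IsSmoothPoint I x ↔
    ∃ i, x.rep i ≠ 0 ∧ IsSmoothAtVec I i (fun c => x.rep c / x.rep i) := Iff.rfl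

/-- A smooth point has a neighbourhood that consists of smooth points and meets only one component. -/
lemma exists_nhds_subset_component (hI : IsConeIdeal I) {Z' : Set (ProjSpace k)}
    (hZ' : IsIrredComponent Z' (projZeroLocus I)) {x : ProjSpace k} (hx : x ∈ Z')
    (hs : IsSmoothPoint I x) :
    ∃ (d : ℕ) (G : CoordRing k), G.IsHomogeneous d ∧ eval x.rep G ≠ 0 ∧
      ∀ y ∈ projZeroLocus I, eval y.rep G ≠ 0 → y ∈ Z' ∧ IsSmoothPoint I y := by
  obtain ⟨i, hxi, hs⟩ := isSmoothPoint_iff.mp hs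
  set a : Fin (k + 1) → ℂ := fun c => x.rep c / x.rep i
  have hchart : ∀ y ∈ projZeroLocus I, ∀ f ∈ I, eval (fun c => y.rep c / y.rep i) f = 0 := by
    intro y hy
    simp_rw [div_eq_inv_mul]
    exact hI.eval_const_mul hy _
  obtain ⟨g', hg'a, hg'⟩ := hs.exists_open
  obtain ⟨p, hp, hIp, hip, hpa, g, hga, hg⟩ := hs.exists_prime
  obtain ⟨d₁, G₁, hG₁, hG₁e⟩ := exists_homogenization i g
  obtain ⟨d₂, G₂, hG₂, hG₂e⟩ := exists_homogenization i g'
  have hXG : (X i * G₁ : CoordRing k).IsHomogeneous (1 + d₁) := (isHomogeneous_X _ _).mul hG₁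
  set W : Set (ProjSpace k) := projZeroLocus I ∩ {y | eval y.rep (X i * G₁) ≠ 0} with hW
  have hxW : eval x.rep (X i * G₁) ≠ 0 := by
    rw [map_mul, eval_X, hG₁e _ hxi]
    exact mul_ne_zero hxi (mul_ne_zero (pow_ne_zero _ hxi) hga)
  -- On `W` the denominator `g` is invertible, so all of `p` vanishes there and not only `I`.
  have hWp : ∀ y ∈ W, ∀ f ∈ p, eval (fun c => y.rep c / y.rep i) f = 0 := by
    rintro y ⟨hy, hyG⟩ f hf
    rw [Set.mem_ofPred_eq, map_mul, eval_X] at hyG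
    have hyi := left_ne_zero_of_mul hyG
    have hyg := right_ne_zero_of_mul hyG
    rw [hG₁e _ hyi] at hyg
    have hle : I ⊔ Ideal.span {X i - 1} ≤ RingHom.ker (eval fun c => y.rep c / y.rep i) := by
      refine sup_le (hchart y hy) ?_
      rw [Ideal.span_le, Set.singleton_subset_iff]
      simp [hyi]
    have := hle (hg f hf)
    rw [RingHom.mem_ker, map_mul] at this
    exact (mul_eq_zero.mp this).resolve_left (right_ne_zero_of_mul hyg)
  have hnotp : ∀ {d : ℕ} {f : CoordRing k}, f.IsHomogeneous d → ∀ y ∈ W, eval y.rep f ≠ 0 →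
      f ∉ p := by
    intro d f hf y hy hfy hfp
    have h := hWp y hy f hfp
    simp_rw [div_eq_inv_mul] at h
    have hyi : y.rep i ≠ 0 := by
      have := hy.2
      rw [Set.mem_ofPred_eq, map_mul, eval_X] at this
      exact left_ne_zero_of_mul this
    rw [hf.eval_const_mul] at h
    exact (mul_ne_zero (pow_ne_zero _ (inv_ne_zero hyi)) hfy) h
  have hx' : x ∈ W := ⟨hZ'.prop.2 hx, hxW⟩
  have hWirr : IsIrreducible W := by
    refine ⟨⟨x, hx'⟩, ?_⟩
    rintro U V hU hV ⟨y, hyW, hyU⟩ ⟨z, hzW, hzV⟩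
    obtain ⟨dU, fU, hfU, hfUy, hfUs⟩ := exists_eval_ne_zero_subset hU hyU
    obtain ⟨dV, fV, hfV, hfVz, hfVs⟩ := exists_eval_ne_zero_subset hV hzV
    -- Since `p` is prime, the product stays outside it, and the Nullstellensatz yields a zero of
    -- `p` at which all three factors are nonzero: a point of `W ∩ U ∩ V`.
    have hprod : fU * fV * g ∉ p := by
      refine hp.mul_notMem (hp.mul_notMem (hnotp hfU y hyW hfUy) (hnotp hfV z hzW hfVz)) ?_
      exact fun h => hga (hpa g h)
    rw [← IsPrime.vanishingIdeal_zeroLocus (K := ℂ) p, mem_vanishingIdeal_iff] at hprod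
    push Not at hprod
    obtain ⟨b, hb, hbne⟩ := hprod
    rw [mem_zeroLocus_iff] at hb
    simp only [aeval_eq_eval, map_mul] at hb hbne
    have hbi : b i = 1 := by simpa [sub_eq_zero] using! hb _ hip
    have hb0 : b ≠ 0 := fun h => by simp [h] at hbi
    have hG₁b : eval b G₁ ≠ 0 := by
      rw [hG₁e b (by simp [hbi])]
      simp only [hbi, one_pow, div_one, one_mul]
      exact right_ne_zero_of_mul hbne
    refine ⟨Projectivization.mk ℂ b hb0, ⟨hI.mk_mem_projZeroLocus hb0 fun f hf => ?_, ?_⟩, ?_, ?_⟩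
    · simpa using! hb f (hIp hf)
    · rw [Set.mem_ofPred_eq, eval_rep_mk_ne_zero_iff hXG, map_mul, eval_X, hbi, one_mul]
      exact hG₁b
    · exact hfUs _ ((eval_rep_mk_ne_zero_iff hfU _ _).mpr
        (left_ne_zero_of_mul (left_ne_zero_of_mul hbne)))
    · exact hfVs _ ((eval_rep_mk_ne_zero_iff hfV _ _).mpr
        (right_ne_zero_of_mul (left_ne_zero_of_mul hbne)))
  have hWZ' : W ⊆ Z' := by
    -- A nonempty open part of the irreducible `Z'` lies in `W`, hence is dense in `Z'`; maximality
    -- of `Z'` then forces `closure W ⊆ Z'`.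
    have hsub : Z' ⊆ closure W := by
      refine (subset_closure_inter_of_isPreirreducible_of_isOpen hZ'.prop.1.2
        (isOpen_setOf_eval_ne_zero hXG) ⟨x, hx, hxW⟩).trans (closure_mono ?_)
      exact Set.inter_subset_inter_left _ hZ'.prop.2
    have hcl : closure W ⊆ projZeroLocus I :=
      closure_minimal Set.inter_subset_left hI.isClosed_projZeroLocus
    exact subset_closure.trans (hZ'.le_of_ge ⟨hWirr.closure, hcl⟩ hsub)
  refine ⟨_, X i * G₁ * G₂, hXG.mul hG₂, ?_, fun y hy hyG => ?_⟩
  · rw [map_mul, hG₂e _ hxi]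
    exact mul_ne_zero hxW (mul_ne_zero (pow_ne_zero _ hxi) hg'a)
  · rw [map_mul] at hyG
    have hyXG := left_ne_zero_of_mul hyG
    refine ⟨hWZ' ⟨hy, hyXG⟩, ?_⟩
    have hyi : y.rep i ≠ 0 := by
      rw [map_mul, eval_X] at hyXG
      exact left_ne_zero_of_mul hyXG
    have hyg := right_ne_zero_of_mul hyG
    rw [hG₂e _ hyi] at hyg
    exact isSmoothPoint_iff.mpr ⟨i, hyi, hg' _ (div_self hyi) (hchart y hy)
      (right_ne_zero_of_mul hyg)⟩

end Zariski

/-! ### Kernel vectors of the critical matrix -/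

section Kernel

variable {k n : ℕ} {h : Fin n → ℕ} {P Q : Cameras k n h}

/-- The value of a linear form with complex coefficients at a vector over an algebra. -/
noncomputable def lin {T : Type*} [CommRing T] [Algebra ℂ T] (r : Fin (k + 1) → ℂ) (x : Fin (k + 1) → T) : T :=
  ∑ b, algebraMap ℂ T (r b) * x b

section lin

variable {T : Type*} [CommRing T] [Algebra ℂ T] (r : Fin (k + 1) → ℂ)

lemma lin_add (x y : Fin (k + 1) → T) : lin r (fun b => x b + y b) = lin r x + lin r y := by
  simp [lin, mul_add, Finset.sum_add_distrib]

lemma lin_const_mul (c : T) (x : Fin (k + 1) → T) : lin r (fun b => c * x b) = c * lin r x := by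
  simp only [lin, Finset.mul_sum]
  exact Finset.sum_congr rfl fun b _ => by ring

lemma lin_algebraMap (x : Fin (k + 1) → ℂ) :
    lin r (fun b => algebraMap ℂ T (x b)) = algebraMap ℂ T (lin r x) := by
  simp [lin]

lemma constantCoeff_lin (x : Fin (k + 1) → PowerSeries ℂ) :
    PowerSeries.constantCoeff (lin r x) = lin r fun b => PowerSeries.constantCoeff (x b) := by
  simp [lin]

end lin

/-- `u` is annihilated by the critical matrix at `x`. -/
def IsKer {T : Type*} [CommRing T] [Algebra ℂ T] (P Q : Cameras k n h) (x : Fin (k + 1) → T)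
    (u : Fin (k + 1) ⊕ Fin n → T) : Prop :=
  ∀ j r, lin (P j r) (fun b => u (.inl b)) + lin (Q j r) x * u (.inr j) = 0

lemma critMatrix_map_mulVec {T : Type*} [CommRing T] [Algebra ℂ T] (x : Fin (k + 1) → T)
    (u : Fin (k + 1) ⊕ Fin n → T) (j : Fin n) (r : Fin (h j + 1)) :
    ((critMatrix P Q).map (aeval x)).mulVec u ⟨j, r⟩ =
      lin (P j r) (fun b => u (.inl b)) + lin (Q j r) x * u (.inr j) := by
  simp [Matrix.mulVec, dotProduct, critMatrix, lin, apply_ite, ite_mul]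

/-- The maximal minors are divisible by `d` if the critical matrix maps a vector with an invertible
coordinate to a multiple of `d`. -/
lemma dvd_aeval_of_mem_critIdeal {T : Type*} [CommRing T] [Algebra ℂ T] {x : Fin (k + 1) → T}
    {u : Fin (k + 1) ⊕ Fin n → T} {d : T}
    (hu : ∀ j r, d ∣ lin (P j r) (fun b => u (.inl b)) + lin (Q j r) x * u (.inr j))
    {c : Fin (k + 1) ⊕ Fin n} (hc : IsUnit (u c)) {f : CoordRing k} (hf : f ∈ critIdeal P Q) :
    d ∣ aeval x f := by
  have hle : critIdeal P Q ≤ (Ideal.span {d}).comap (aeval x) := by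
    refine Ideal.span_le.mpr ?_
    rintro _ ⟨e, rfl⟩
    rw [SetLike.mem_coe, Ideal.mem_comap, Ideal.mem_span_singleton, AlgHom.map_det]
    set N := (aeval x).mapMatrix ((critMatrix P Q).submatrix e id) with hN
    -- Cramer's rule: `det N * u c` is a combination of entries of `N u`, all divisible by `d`.
    have h1 : N.adjugate.mulVec (N.mulVec u) = N.det • u := by
      rw [Matrix.mulVec_mulVec, Matrix.adjugate_mul, Matrix.smul_mulVec, Matrix.one_mulVec]
    have h2 : ∀ s, d ∣ N.mulVec u s := by
      intro s
      have := hu (e s).1 (e s).2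
      rw [← critMatrix_map_mulVec] at this
      exact this
    have h3 : d ∣ N.det * u c := by
      have := congrFun h1 c
      rw [Pi.smul_apply, smul_eq_mul] at this
      rw [← this, Matrix.mulVec, dotProduct]
      exact Finset.dvd_sum fun s _ => Dvd.dvd.mul_left (h2 s) _
    exact hc.dvd_mul_right.mp h3
  exact Ideal.mem_span_singleton.mp (hle hf)

lemma IsKer.eval_eq_zero {x : Fin (k + 1) → ℂ} {u : Fin (k + 1) ⊕ Fin n → ℂ}
    (hu : IsKer P Q x u) (hu0 : u ≠ 0) : ∀ f ∈ critIdeal P Q, eval x f = 0 := by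
  intro f hf
  obtain ⟨c, hc⟩ := Function.ne_iff.mp hu0
  have := dvd_aeval_of_mem_critIdeal (d := 0) (fun j r => by rw [hu j r])
    (isUnit_iff_ne_zero.mpr hc) hf
  simpa using! this

/-- Cofactors of the critical matrix: a vector of the kernel, provided the maximal minors vanish. -/
noncomputable def critW (P Q : Cameras k n h) (e : Fin (k + 1) ⊕ Fin n → Σ j : Fin n, Fin (h j + 1))
    (s c : Fin (k + 1) ⊕ Fin n) : CoordRing k :=
  ((critMatrix P Q).submatrix e id).adjugate c s

variable {e : Fin (k + 1) ⊕ Fin n → Σ j : Fin n, Fin (h j + 1)} {s : Fin (k + 1) ⊕ Fin n}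

lemma critW_eq_det (c : Fin (k + 1) ⊕ Fin n) : critW P Q e s c =
    (((critMatrix P Q).submatrix e id).updateRow s (Pi.single c 1)).det :=
  Matrix.adjugate_apply _ _ _

/-- The sum is the Laplace expansion, along row `s`, of the matrix in which that row has been
replaced by row `ρ`. This is again a maximal minor, possibly with a repeated row. -/
lemma sum_critMatrix_mul_critW_mem (ρ : Σ j : Fin n, Fin (h j + 1)) :
    ∑ c, critMatrix P Q ρ c * critW P Q e s c ∈ critIdeal P Q := by
  have h1 : ((critMatrix P Q).submatrix e id).updateRow s (critMatrix P Q ρ) =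
      (critMatrix P Q).submatrix (Function.update e s ρ) id := by
    ext a c
    by_cases ha : a = s
    · subst ha; simp
    · simp [Matrix.updateRow_ne ha, Function.update_of_ne ha]
  have h2 : ∑ c, critMatrix P Q ρ c * critW P Q e s c =
      ((critMatrix P Q).submatrix (Function.update e s ρ) id).det := by
    rw [← h1, Matrix.det_eq_sum_mul_adjugate_row _ s]
    refine Finset.sum_congr rfl fun c _ => ?_
    rw [Matrix.updateRow_self, critW, Matrix.adjugate_apply, Matrix.adjugate_apply,
      Matrix.updateRow_idem]
  rw [h2]
  exact Ideal.subset_span ⟨_, rfl⟩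

lemma isKer_critW {T : Type*} [CommRing T] [Algebra ℂ T] {x : Fin (k + 1) → T}
    (hx : ∀ f ∈ critIdeal P Q, aeval x f = 0) : IsKer P Q x fun c => aeval x (critW P Q e s c) := by
  intro j r
  have h1 := critMatrix_map_mulVec (P := P) (Q := Q) x (fun c => aeval x (critW P Q e s c)) j r
  have h2 := hx _ (sum_critMatrix_mul_critW_mem (e := e) (s := s) ⟨j, r⟩)
  rw [← h1, ← h2]
  simp only [Matrix.mulVec, dotProduct, Matrix.map_apply, map_sum, map_mul]

/-- If some cofactor is nonzero, the cofactors span the kernel. -/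
lemma IsKer.mul_eq {x : Fin (k + 1) → ℂ} {u : Fin (k + 1) ⊕ Fin n → ℂ}
    (hx : ∀ f ∈ critIdeal P Q, eval x f = 0) (hu : IsKer P Q x u) {c : Fin (k + 1) ⊕ Fin n}
    (hc : eval x (critW P Q e s c) ≠ 0) (b : Fin (k + 1) ⊕ Fin n) :
    eval x (critW P Q e s c) * u b = u c * eval x (critW P Q e s b) := by
  have hw := isKer_critW (P := P) (Q := Q) (e := e) (s := s) (x := x) (fun f hf => by
    simpa using! hx f hf)
  simp only [aeval_eq_eval] at hw
  set w : Fin (k + 1) ⊕ Fin n → ℂ := fun c => eval x (critW P Q e s c) with hwdef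
  let N := ((critMatrix P Q).map (aeval x)).submatrix e id
  have hdet : (N.updateRow s (Pi.single c 1)).det = w c := by
    simp only [hwdef, critW_eq_det]
    rw [RingHom.map_det]
    congr 1
    ext a b
    by_cases ha : a = s
    · subst ha
      simp [Pi.single_apply, apply_ite]
    · simp [Matrix.updateRow_ne ha, N]
  have hmul : ∀ u : Fin (k + 1) ⊕ Fin n → ℂ, IsKer P Q x u →
      (N.updateRow s (Pi.single c 1)).mulVec u = Pi.single s (u c) := by
    intro u hu
    ext a
    by_cases ha : a = s
    · subst ha
      simp [Matrix.mulVec]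
    · rw [Pi.single_eq_of_ne ha]
      have := critMatrix_map_mulVec (P := P) (Q := Q) x u (e a).1 (e a).2
      rw [hu] at this
      simpa [Matrix.mulVec, Matrix.updateRow_ne ha, N] using! this
  -- With row `s` replaced by the unit vector at `c`, the matrix is invertible and maps each kernel
  -- vector `u` to `u c` times the unit vector at `s`. Hence it kills `w c • u - u c • w`.
  have hz := Matrix.eq_zero_of_mulVec_eq_zero (M := N.updateRow s (Pi.single c 1))
    (v := w c • u - u c • w) (by rw [hdet]; exact hc) (by
      rw [Matrix.mulVec_sub, Matrix.mulVec_smul, Matrix.mulVec_smul, hmul u hu, hmul w hw]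
      ext a
      by_cases ha : a = s
      · subst ha; simp; ring
      · simp [ha])
  have := congrFun hz b
  simpa [sub_eq_zero] using this

/-! #### Homogeneity -/

lemma det_isHomogeneous {ι : Type*} [Fintype ι] [DecidableEq ι] (A : Matrix ι ι (CoordRing k))
    (d : ι → ℕ) (hA : ∀ r c, (A r c).IsHomogeneous (d c)) :
    A.det.IsHomogeneous (∑ c, d c) := by
  rw [Matrix.det_apply]
  refine IsHomogeneous.sum _ _ _ fun σ _ => ?_
  have := IsHomogeneous.prod Finset.univ (fun c => A (σ c) c) d fun c _ => hA _ _
  rcases Int.units_eq_one_or (Equiv.Perm.sign σ) with h1 | h1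
  · simpa [h1] using this
  · simpa [h1] using this.neg

lemma critMatrix_isHomogeneous (ρ : Σ j : Fin n, Fin (h j + 1)) (c : Fin (k + 1) ⊕ Fin n) :
    (critMatrix P Q ρ c).IsHomogeneous (Sum.elim (fun _ => 0) (fun _ => 1) c) := by
  rcases c with b | l
  · exact isHomogeneous_C _ _
  · simp only [critMatrix, Matrix.of_apply, Sum.elim_inr]
    split_ifs
    · exact IsHomogeneous.sum _ _ _ fun b _ => (isHomogeneous_X _ _).C_mul _
    · exact isHomogeneous_zero _ _ _

lemma isConeIdeal_critIdeal (P Q : Cameras k n h) : IsConeIdeal (critIdeal P Q) := by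
  refine ⟨_, ?_, rfl⟩
  rintro _ ⟨e, rfl⟩
  exact ⟨_, det_isHomogeneous _ _ fun r c => critMatrix_isHomogeneous _ _⟩

lemma critW_inl_isHomogeneous (b : Fin (k + 1)) : (critW P Q e s (.inl b)).IsHomogeneous n := by
  rw [critW_eq_det]
  have := det_isHomogeneous (((critMatrix P Q).submatrix e id).updateRow s (Pi.single (.inl b) 1))
    (Sum.elim (fun _ => 0) (fun _ => 1)) fun r c => by
      by_cases hr : r = s
      · subst hr
        rw [Matrix.updateRow_self, Pi.single_apply]
        split_ifs with hc
        · subst hc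
          exact isHomogeneous_one _ _
        · exact isHomogeneous_zero _ _ _
      · rw [Matrix.updateRow_ne hr]
        exact critMatrix_isHomogeneous _ _
  simpa using this

/-- A unit vector in a linear column breaks the columnwise homogeneity that `det_isHomogeneous`
needs. Multiplying that row by `X i` restores it, and the factor also confines later nonvanishing
conditions to the chart. -/
lemma X_mul_critW_isHomogeneous (i : Fin (k + 1)) (c : Fin (k + 1) ⊕ Fin n) :
    ∃ d, (X i * critW P Q e s c).IsHomogeneous d := by
  rcases c with b | l
  · exact ⟨_, (isHomogeneous_X _ _).mul (critW_inl_isHomogeneous b)⟩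
  · have h1 : X i * critW P Q e s (.inr l) = (((critMatrix P Q).submatrix e id).updateRow s
        ((X i : CoordRing k) • (Pi.single (.inr l) 1 : Fin (k + 1) ⊕ Fin n → CoordRing k))).det := by
      rw [Matrix.det_updateRow_smul, ← critW_eq_det]
    refine ⟨_, h1 ▸ det_isHomogeneous _ (Sum.elim (fun _ => 0) (fun _ => 1)) fun r c => ?_⟩
    by_cases hr : r = s
    · subst hr
      rw [Matrix.updateRow_self, Pi.smul_apply, Pi.single_apply]
      split_ifs with hc
      · subst hc
        simpa using! isHomogeneous_X _ _
      · simpa using! isHomogeneous_zero _ _ _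
    · rw [Matrix.updateRow_ne hr]
      exact critMatrix_isHomogeneous _ _

/-! #### Nonvanishing cofactors -/

/-- Some cofactor of the critical matrix does not vanish at `x`. -/
def HasCofactor (P Q : Cameras k n h) (x : Fin (k + 1) → ℂ) : Prop :=
  ∃ e s c, eval x (critW P Q e s c) ≠ 0

lemma hasCofactor_of_rank (hn : n ≠ 0) (x : Fin (k + 1) → ℂ)
    (hr : ((critMatrix P Q).map (eval x)).rank = k + n) : HasCofactor P Q x := by
  set A := (critMatrix P Q).map (eval x) with hA
  obtain ⟨κ, a, ha, hspan, hli⟩ := exists_linearIndependent' ℂ A.row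
  have : Fintype κ := @Fintype.ofFinite κ (Finite.of_injective a ha)
  have hcard : Fintype.card κ = k + n := by
    rw [← hr, Matrix.rank_eq_finrank_span_row, ← hspan, finrank_span_eq_card hli]
  -- The `k + n` independent rows do not span, so some unit vector completes them to a basis; the
  -- determinant of this basis is a cofactor.
  obtain ⟨c, hc⟩ : ∃ c, (Pi.single c 1 : Fin (k + 1) ⊕ Fin n → ℂ) ∉
      Submodule.span ℂ (Set.range (A.row ∘ a)) := by
    by_contra! hcon
    have htop : Submodule.span ℂ (Set.range (A.row ∘ a)) = ⊤ := by
      rw [eq_top_iff, ← (Pi.basisFun ℂ (Fin (k + 1) ⊕ Fin n)).span_eq, Submodule.span_le]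
      rintro _ ⟨c, rfl⟩
      simpa using hcon c
    have := finrank_span_eq_card hli
    rw [htop, finrank_top, hcard, Module.finrank_fintype_fun_eq_card] at this
    simp at this
  have hli' := linearIndependent_option' |>.mpr ⟨hli, hc⟩
  have hcard' : Fintype.card (Fin (k + 1) ⊕ Fin n) = Fintype.card (Option κ) := by
    simp [hcard]; lia
  let σ : Fin (k + 1) ⊕ Fin n ≃ Option κ := Fintype.equivOfCardEq hcard'
  have hli'' := hli'.comp σ σ.injective
  -- A dummy row for the position `s`, overwritten in the cofactor; it exists because `n ≠ 0`.
  let ρ₀ : Σ j : Fin n, Fin (h j + 1) := ⟨⟨0, Nat.pos_of_ne_zero hn⟩, 0⟩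
  refine ⟨fun t => (σ t).elim ρ₀ a, σ.symm none, c, ?_⟩
  rw [critW_eq_det, RingHom.map_det]
  rw [← isUnit_iff_ne_zero, ← Matrix.isUnit_iff_isUnit_det, ← Matrix.linearIndependent_rows_iff_isUnit]
  convert! hli'' using 1
  ext t b
  rcases ht : σ t with _ | t'
  · have : t = σ.symm none := by rw [← ht]; simp
    subst this
    simp [Matrix.row, Pi.single_apply, apply_ite]
  · have : t ≠ σ.symm none := fun h0 => by rw [h0] at ht; simp at ht
    simp only [RingHom.mapMatrix_apply, Matrix.row, Matrix.map_apply, Matrix.updateRow_ne this,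
      Matrix.submatrix_apply, ht, Function.comp_apply, Option.casesOn'_some, Option.elim_some, id_eq]
    rfl

/-- For size `m + 1`, `det (adj A) = det A ^ m` is divisible by `π ^ (m + 1)`, so `det A = π * q`.
Cancelling `π ^ m` leaves `π ∣ q ^ m`. With `π = X`, it says that corank at least two makes a
determinant vanish doubly. -/
lemma sq_dvd_det_of_dvd_adjugate {ι : Type*} [Fintype ι] [DecidableEq ι] [Nonempty ι]
    {T : Type*} [CommRing T] [IsDomain T] {π : T} (hπ : Prime π) (A : Matrix ι ι T)
    (hA : ∀ i j, π ∣ A.adjugate i j) : π ^ 2 ∣ A.det := by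
  choose B hB using hA
  have hAB : A.adjugate = π • Matrix.of B := by
    ext i j; simp [hB]
  have h1 := A.det_adjugate
  rw [hAB, Matrix.det_smul] at h1
  obtain ⟨m, hm⟩ : ∃ m, Fintype.card ι = m + 1 := ⟨_, (Nat.succ_pred Fintype.card_ne_zero).symm⟩
  rw [hm, Nat.add_sub_cancel] at h1
  obtain ⟨q, hq⟩ : π ∣ A.det := by
    refine hπ.dvd_of_dvd_pow (n := m) ?_
    rw [← h1, pow_succ', mul_assoc]
    exact dvd_mul_right _ _
  rw [hq, mul_pow, pow_succ, mul_assoc] at h1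
  have h2 := mul_left_cancel₀ (pow_ne_zero _ hπ.ne_zero) h1
  obtain ⟨q', hq'⟩ : π ∣ q := hπ.dvd_of_dvd_pow (n := m) (h2 ▸ dvd_mul_right _ _)
  exact ⟨q', by rw [hq, hq']; ring⟩

/-- If all cofactors vanish at `x`, every maximal minor vanishes to second order along every line
through `x`. The tangent space is then the ambient one, and smoothness forces all minors to vanish
on the chart, hence identically. -/
lemma critLocus_eq_univ_of_smooth {x : ProjSpace k} (hs : IsSmoothPoint (critIdeal P Q) x)
    (hx : ¬ HasCofactor P Q x.rep) : critLocus P Q = Set.univ := by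
  obtain ⟨i, hxi, hs⟩ := isSmoothPoint_iff.mp hs
  set a : Fin (k + 1) → ℂ := fun c => x.rep c / x.rep i
  have ha : ∀ e s c, eval a (critW P Q e s c) = 0 := by
    intro e s c
    obtain ⟨d, hd⟩ := X_mul_critW_isHomogeneous (P := P) (Q := Q) (e := e) (s := s) i c
    have h1 := hd.eval_const_mul (x.rep i)⁻¹ x.rep
    simp_rw [← div_eq_inv_mul] at h1
    have h2 : eval x.rep (critW P Q e s c) = 0 := by
      by_contra h0
      exact hx ⟨e, s, c, h0⟩
    rw [map_mul, map_mul, h2, mul_zero, mul_zero, eval_X, div_self hxi, one_mul] at h1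
    exact h1
  have ht : ∀ v : Fin (k + 1) → ℂ, ∀ f ∈ critIdeal P Q, PowerSeries.X ^ 2 ∣
      aeval (fun c => PowerSeries.C (a c) + PowerSeries.X * PowerSeries.C (v c)) f := by
    intro v
    set ℓ : Fin (k + 1) → PowerSeries ℂ :=
      fun c => PowerSeries.C (a c) + PowerSeries.X * PowerSeries.C (v c) with hℓ
    have hle : critIdeal P Q ≤ (Ideal.span {(PowerSeries.X : PowerSeries ℂ) ^ 2}).comap
        (aeval ℓ) := by
      refine Ideal.span_le.mpr ?_
      rintro _ ⟨e, rfl⟩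
      rw [SetLike.mem_coe, Ideal.mem_comap, Ideal.mem_span_singleton, AlgHom.map_det]
      refine sq_dvd_det_of_dvd_adjugate PowerSeries.X_prime _ fun c s => ?_
      rw [← AlgHom.map_adjugate, PowerSeries.X_dvd_iff]
      change PowerSeries.constantCoeff (aeval ℓ (critW P Q e s c)) = 0
      rw [constantCoeff_aeval]
      have : (fun c => PowerSeries.constantCoeff (ℓ c)) = a := by ext c; simp [hℓ]
      rw [this, ha]
    exact fun f hf => Ideal.mem_span_singleton.mp (hle hf)
  refine Set.eq_univ_of_forall fun y => ?_
  have hle : critIdeal P Q ≤ RingHom.ker (eval y.rep) := by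
    refine Ideal.span_le.mpr ?_
    rintro _ ⟨e, rfl⟩
    set f := ((critMatrix P Q).submatrix e id).det with hf
    have hfI : f ∈ critIdeal P Q := Ideal.subset_span ⟨e, rfl⟩
    have hfh := det_isHomogeneous ((critMatrix P Q).submatrix e id) _
      fun r c => critMatrix_isHomogeneous _ _
    rw [← hf] at hfh
    have h0 : X i * f = 0 := by
      refine funext fun z => ?_
      rw [map_mul, eval_X, map_zero, mul_eq_zero]
      by_cases hzi : z i = 0
      · exact .inl hzi
      · have h1 := hs.eval_eq_zero_of_forall_tangent ht hfI (fun c => (z i)⁻¹ * z c)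
          (inv_mul_cancel₀ hzi)
        rw [hfh.eval_const_mul] at h1
        exact .inr ((mul_eq_zero.mp h1).resolve_left (pow_ne_zero _ (inv_ne_zero hzi)))
    have hf0 : f = 0 := (mul_eq_zero.mp h0).resolve_left (X_ne_zero i)
    change eval y.rep f = 0
    rw [hf0, map_zero]
  exact fun f hf => hle hf

/-- At a smooth point of the critical locus the critical matrix has corank one, unless the critical
locus is the whole space. -/
lemma IsSmoothPoint.hasCofactor (hn : n ≠ 0) {x : ProjSpace k}
    (hs : IsSmoothPoint (critIdeal P Q) x)
    (hr : critLocus P Q = Set.univ → critRank P Q x = k + n) : HasCofactor P Q x.rep := by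
  by_contra hx
  exact hx (hasCofactor_of_rank hn x.rep (hr (critLocus_eq_univ_of_smooth hs hx)))

end Kernel

/-! ### The fibres of the unified critical locus -/

section Fibres

variable {k n : ℕ} {h : Fin n → ℕ} {P Q : Cameras k n h}

lemma mem_unifiedLocus_swap {x y : ProjSpace k} :
    (x, y) ∈ unifiedLocus P Q ↔ (y, x) ∈ unifiedLocus Q P := by
  simp only [unifiedLocus, Set.mem_ofPred_eq]
  constructor
  · exact fun ⟨h1, h2, h3⟩ => ⟨h2, h1, fun j a b => by rw [mul_comm, h3 j b a, mul_comm]⟩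
  · exact fun ⟨h1, h2, h3⟩ => ⟨h2, h1, fun j a b => by rw [mul_comm, h3 j b a, mul_comm]⟩

/-- No camera `Q_j` is undefined at `x`. -/
def IsDefinedAt (Q : Cameras k n h) (x : Fin (k + 1) → ℂ) : Prop :=
  ∀ j, ∃ r, lin (Q j r) x ≠ 0

/-- The minors make `P_j(y)` a multiple of the nonzero vector `Q_j(x)`; the negated factor is the
`j`-th additional coordinate. -/
lemma exists_isKer_of_cross {x y : Fin (k + 1) → ℂ} (hx : IsDefinedAt Q x)
    (hc : ∀ j a b, lin (Q j a) x * lin (P j b) y = lin (Q j b) x * lin (P j a) y) :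
    ∃ u, IsKer P Q x u ∧ ∀ b, u (.inl b) = y b := by
  choose r hr using hx
  refine ⟨Sum.elim y fun j => - (lin (P j (r j)) y / lin (Q j (r j)) x), fun j a => ?_,
    fun b => rfl⟩
  have h1 := hc j (r j) a
  have h2 := hr j
  simp only [Sum.elim_inl, Sum.elim_inr]
  field_simp
  linear_combination h1

lemma isKer_single {x : Fin (k + 1) → ℂ} {j : Fin n} (hj : ∀ r, lin (Q j r) x = 0) :
    IsKer P Q x (Pi.single (.inr j) 1) := by
  intro l r
  have h1 : lin (P l r) (fun b => (Pi.single (.inr j) 1 : Fin (k + 1) ⊕ Fin n → ℂ) (.inl b)) = 0 := by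
    simp [lin]
  rw [h1, zero_add]
  by_cases hl : l = j
  · subst hl
    rw [hj, zero_mul]
  · rw [Pi.single_eq_of_ne (by simpa using hl), mul_zero]

/-- The critical matrix has a nonzero kernel vector in either case: one extending `y`, or a unit
vector when some `Q_j(x)` vanishes. So the proportionality conditions alone define the unified
locus. -/
lemma mem_critLocus_of_cross {x y : ProjSpace k}
    (hc : ∀ j a b, lin (Q j a) x.rep * lin (P j b) y.rep = lin (Q j b) x.rep * lin (P j a) y.rep) :
    x ∈ critLocus P Q := by
  by_cases hx : IsDefinedAt Q x.rep
  · obtain ⟨u, hu, huy⟩ := exists_isKer_of_cross hx hc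
    refine hu.eval_eq_zero fun h0 => y.rep_nonzero ?_
    ext b
    rw [← huy, h0]
    rfl
  · simp only [IsDefinedAt, not_forall, not_exists, not_not] at hx
    obtain ⟨j, hj⟩ := hx
    exact (isKer_single hj).eval_eq_zero fun h0 => by
      simpa using congrFun h0 (.inr j)

lemma mem_unifiedLocus_iff {x y : ProjSpace k} : (x, y) ∈ unifiedLocus P Q ↔
    ∀ j a b, lin (Q j a) x.rep * lin (P j b) y.rep = lin (Q j b) x.rep * lin (P j a) y.rep := by
  refine ⟨fun hU => hU.2.2, fun hc => ⟨mem_critLocus_of_cross hc, ?_, hc⟩⟩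
  exact mem_critLocus_of_cross (y := x) fun j a b =>
    (mul_comm _ _).trans ((hc j b a).trans (mul_comm _ _))

/-- Where the cameras are defined and the critical matrix has corank one, the fibre of the unified
critical locus is the point given by the cofactors. -/
lemma exists_fibre_eq {x : ProjSpace k} (hx : x ∈ critLocus P Q) (hQ : IsDefinedAt Q x.rep)
    {e : Fin (k + 1) ⊕ Fin n → Σ j : Fin n, Fin (h j + 1)} {s c : Fin (k + 1) ⊕ Fin n}
    (hc : eval x.rep (critW P Q e s c) ≠ 0) :
    ∃ hw : (fun b => eval x.rep (critW P Q e s (.inl b))) ≠ 0, ∀ y,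
      (x, y) ∈ unifiedLocus P Q ↔ y = Projectivization.mk ℂ _ hw := by
  have hker := isKer_critW (P := P) (Q := Q) (e := e) (s := s) (x := x.rep) (fun f hf => by
    simpa using! hx f hf)
  simp only [aeval_eq_eval] at hker
  have hw : (fun b => eval x.rep (critW P Q e s (.inl b))) ≠ 0 := by
    -- A kernel vector concentrated on the last `n` coordinates would need `Q_l(x) = 0` wherever its
    -- `l`-th entry is nonzero.
    intro h0
    have hinl : ∀ b, eval x.rep (critW P Q e s (.inl b)) = 0 := fun b => congrFun h0 b
    rcases c with b | l
    · exact hc (hinl b)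
    · obtain ⟨r, hr⟩ := hQ l
      have := hker l r
      simp only [hinl] at this
      simp [lin] at this
      exact this.elim hr hc
  refine ⟨hw, fun y => ⟨fun hU => ?_, ?_⟩⟩
  · obtain ⟨u, hu, huy⟩ := exists_isKer_of_cross hQ (mem_unifiedLocus_iff.mp hU)
    have hmul := hu.mul_eq hx hc
    rw [← y.mk_rep, Projectivization.mk_eq_mk_iff']
    refine ⟨u c / eval x.rep (critW P Q e s c), ?_⟩
    ext b
    rw [← huy, Pi.smul_apply, smul_eq_mul, div_mul_eq_mul_div, div_eq_iff hc, ← hmul, mul_comm]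
  · rintro rfl
    rw [mem_unifiedLocus_iff]
    intro j a b
    obtain ⟨t, -, ht⟩ := exists_rep_mk_eq _ hw
    rw [ht, lin_const_mul, lin_const_mul]
    have h1 := hker j a
    have h2 := hker j b
    simp only at h1 h2
    linear_combination t * lin (Q j a) x.rep * h2 - t * lin (Q j b) x.rep * h1

end Fibres

/-! ### Deforming a point of the unified critical locus -/

section Deformation

variable {k n : ℕ} {h : Fin n → ℕ} {P Q : Cameras k n h}

lemma eval_lin_X (r x : Fin (k + 1) → ℂ) :
    eval x (lin r (X : Fin (k + 1) → CoordRing k)) = lin r x := by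
  simp [lin]

lemma aeval_lin_X {T : Type*} [CommRing T] [Algebra ℂ T] (r : Fin (k + 1) → ℂ)
    (x : Fin (k + 1) → T) : aeval x (lin r (X : Fin (k + 1) → CoordRing k)) = lin r x := by
  simp [lin]

lemma lin_X_isHomogeneous (r : Fin (k + 1) → ℂ) :
    (lin r (X : Fin (k + 1) → CoordRing k)).IsHomogeneous 1 :=
  IsHomogeneous.sum _ _ _ fun _ _ => (isHomogeneous_X _ _).C_mul _

lemma exists_mulVec_eq {m : ℕ} (A : Matrix (Fin m) (Fin (k + 1)) ℂ) (hA : A.rank = m)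
    (y : Fin m → ℂ) : ∃ v, ∀ r, lin (A r) v = y r := by
  have hsurj : Function.Surjective A.mulVecLin := by
    rw [← LinearMap.range_eq_top]
    refine Submodule.eq_top_of_finrank_eq ?_
    rw [← Matrix.rank, hA]
    simp
  obtain ⟨v, hv⟩ := hsurj y
  exact ⟨v, fun r => congrFun hv r⟩

/-- The unified critical locus can be moved, over a smooth point of the first critical locus, into
the open set where the cameras are defined. -/
lemma exists_mem_unifiedLocus_isDefinedAt (hQ : AreProjections Q) {x₀ y₀ : ProjSpace k}
    (hU : (x₀, y₀) ∈ unifiedLocus P Q) (hs : IsSmoothPoint (critIdeal P Q) x₀)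
    (hcof : HasCofactor P Q x₀.rep) {F G : CoordRing k} {dF dG : ℕ} (hF : F.IsHomogeneous dF)
    (hG : G.IsHomogeneous dG) (hFx : eval x₀.rep F ≠ 0) (hGy : eval y₀.rep G ≠ 0) :
    ∃ x₁ y₁, (x₁, y₁) ∈ unifiedLocus P Q ∧ eval x₁.rep F ≠ 0 ∧ eval y₁.rep G ≠ 0 ∧
      IsDefinedAt Q x₁.rep := by
  by_cases hdef : IsDefinedAt Q x₀.rep
  · exact ⟨x₀, y₀, hU, hFx, hGy, hdef⟩
  simp only [IsDefinedAt, not_forall, not_exists, not_not] at hdef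
  obtain ⟨j, hj⟩ := hdef
  obtain ⟨i, hxi, hs⟩ := isSmoothPoint_iff.mp hs
  set a : Fin (k + 1) → ℂ := fun c => x₀.rep c / x₀.rep i
  have hadef : a = fun c => (x₀.rep i)⁻¹ * x₀.rep c := by ext c; exact div_eq_inv_mul _ _
  have hinv := inv_ne_zero hxi
  have hai : a i = 1 := div_self hxi
  have hlin : ∀ r : Fin (k + 1) → ℂ, lin r a = (x₀.rep i)⁻¹ * lin r x₀.rep := fun r => by
    rw [hadef, lin_const_mul]
  have hFa : eval a F ≠ 0 := by
    rw [hadef, hF.eval_const_mul]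
    exact mul_ne_zero (pow_ne_zero _ hinv) hFx
  have ha : ∀ f ∈ critIdeal P Q, eval a f = 0 := by
    rw [hadef]
    exact (isConeIdeal_critIdeal P Q).eval_const_mul hU.1 _
  have hja : ∀ r, lin (Q j r) a = 0 := fun r => by rw [hlin, hj, mul_zero]
  -- the kernel of the critical matrix at `a`
  obtain ⟨e, s, c, hc⟩ := hcof
  have hca : eval a (critW P Q e s c) ≠ 0 := by
    obtain ⟨d, hd⟩ := X_mul_critW_isHomogeneous (P := P) (Q := Q) (e := e) (s := s) i c
    have h1 := hd.eval_const_mul (x₀.rep i)⁻¹ x₀.rep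
    rw [← hadef, map_mul, map_mul, eval_X, eval_X, hai, one_mul] at h1
    rw [h1]
    exact mul_ne_zero (pow_ne_zero _ hinv) (mul_ne_zero hxi hc)
  -- As `Q_j(a) = 0`, the unit vector at `j` spans the one-dimensional kernel. Every kernel vector
  -- is therefore determined by its `j`-th entry.
  have hsingle := (isKer_single (P := P) hja).mul_eq ha hca
  have hcj : c = .inr j := by
    by_contra hne
    have := hsingle (.inr j)
    rw [Pi.single_eq_same, Pi.single_eq_of_ne hne, mul_one, zero_mul] at this
    exact hca this
  subst hcj
  have hW0 : ∀ b, b ≠ .inr j → eval a (critW P Q e s b) = 0 := by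
    intro b hb
    have := hsingle b
    rwa [Pi.single_eq_same, Pi.single_eq_of_ne hb, mul_zero, one_mul, eq_comm] at this
  have hker0 : ∀ u, IsKer P Q a u → u (.inr j) = 0 → ∀ b, u b = 0 := by
    intro u hu huj b
    have := hu.mul_eq ha hca b
    rw [huj, zero_mul] at this
    exact (mul_eq_zero.mp this).resolve_left hca
  set y := y₀.rep with hy
  have hcross : ∀ l r r', lin (Q l r) a * lin (P l r') y = lin (Q l r') a * lin (P l r) y := by
    intro l r r'
    rw [hlin, hlin, mul_assoc, mul_assoc, mem_unifiedLocus_iff.mp hU l r r']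
  -- A second camera undefined at `a` would give a second independent kernel vector.
  have hdefl : ∀ l, l ≠ j → ∃ r, lin (Q l r) a ≠ 0 := by
    intro l hl
    by_contra! hcon
    have := hker0 _ (isKer_single (P := P) hcon) (Pi.single_eq_of_ne (by simpa using hl.symm) _)
      (.inr l)
    simp at this
  obtain ⟨m, hm⟩ : ∃ m : Fin n → ℂ, ∀ l, l ≠ j → ∀ r, lin (P l r) y = m l * lin (Q l r) a := by
    have : ∀ l, ∃ m : ℂ, l ≠ j → ∀ r, lin (P l r) y = m * lin (Q l r) a := by
      intro l
      by_cases hl : l = j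
      · exact ⟨0, fun h0 => absurd hl h0⟩
      · obtain ⟨r, hr⟩ := hdefl l hl
        refine ⟨lin (P l r) y / lin (Q l r) a, fun _ r' => ?_⟩
        have := hcross l r r'
        field_simp
        linear_combination this
    choose m hm using this
    exact ⟨m, hm⟩
  -- Otherwise `(y, -m)` with `j`-th entry `0` would be a kernel vector, forcing `y = 0`.
  have hPj : ∃ r, lin (P j r) y ≠ 0 := by
    by_contra! hcon
    refine y₀.rep_nonzero ?_
    have := hker0 (Sum.elim y fun l => if l = j then 0 else - m l) ?_ (by simp)
    · ext b
      exact this (.inl b)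
    · intro l r
      simp only [Sum.elim_inl, Sum.elim_inr]
      by_cases hl : l = j
      · subst hl
        simp [hcon]
      · rw [if_neg hl, hm l hl]
        ring
  obtain ⟨ri, hri⟩ : ∃ r : ∀ l, Fin (h l + 1), ∀ l, (l ≠ j → lin (Q l (r l)) a ≠ 0) ∧
      (l = j → lin (P l (r l)) y ≠ 0) := by
    have : ∀ l, ∃ r, (l ≠ j → lin (Q l r) a ≠ 0) ∧ (l = j → lin (P l r) y ≠ 0) := by
      intro l
      by_cases hl : l = j
      · subst hl
        obtain ⟨r, hr⟩ := hPj
        exact ⟨r, fun h0 => absurd rfl h0, fun _ => hr⟩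
      · obtain ⟨r, hr⟩ := hdefl l hl
        exact ⟨r, fun _ => hr, fun h0 => absurd h0 hl⟩
    choose r hr using this
    exact ⟨r, hr⟩
  -- a tangent vector
  obtain ⟨v, hvi, hv⟩ : ∃ v : Fin (k + 1) → ℂ, v i = 0 ∧ ∀ r, lin (Q j r) v = lin (P j r) y := by
    obtain ⟨v, hv⟩ := exists_mulVec_eq (Q j) (hQ j) fun r => lin (P j r) y
    refine ⟨fun b => v b + (- v i) * a b, by simp [hai], fun r => ?_⟩
    rw [lin_add, lin_const_mul, hja, hv, mul_zero, add_zero]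
  have hlinℓ : ∀ r : Fin (k + 1) → ℂ,
      lin r (fun b => PowerSeries.C (a b) + PowerSeries.X * PowerSeries.C (v b)) =
        PowerSeries.C (lin r a) + PowerSeries.X * PowerSeries.C (lin r v) := by
    intro r
    rw [lin_add, lin_const_mul]
    exact congr($(lin_algebraMap r a) + PowerSeries.X * $(lin_algebraMap r v))
  obtain ⟨γ, hγ, hγi, hγI⟩ := hs.exists_curve v hvi (by
    intro f hf
    -- The vector `(X y, -e_j - X m)`, with the term at `j` dropped from `m`, is killed modulo `X ^
    -- 2` along the line `a + X v`. Its entry `-1` is a unit, so the minors vanish modulo `X ^ 2`.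
    refine dvd_aeval_of_mem_critIdeal (P := P) (Q := Q)
      (u := Sum.elim (fun b => PowerSeries.X * PowerSeries.C (y b))
        fun l => if l = j then -1 else - (PowerSeries.X * PowerSeries.C (m l))) ?_
      (c := .inr j) (by simp) hf
    intro l r
    simp only [Sum.elim_inl, Sum.elim_inr, hlinℓ, lin_const_mul]
    rw [show lin (P l r) (fun b => PowerSeries.C (y b)) = PowerSeries.C (lin (P l r) y) from
      lin_algebraMap _ _]
    by_cases hl : l = j
    · subst hl
      rw [if_pos rfl, hja, hv]
      simp
    · rw [if_neg hl, hm l hl]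
      refine ⟨- PowerSeries.C (lin (Q l r) v) * PowerSeries.C (m l), ?_⟩
      rw [map_mul]
      ring)
  choose w hw using hγ
  have hγ' : γ = fun b => (PowerSeries.C (a b) + PowerSeries.X * PowerSeries.C (v b)) +
      PowerSeries.X ^ 2 * w b := by
    ext1 b
    rw [← hw]
    ring
  have hγ0 : (fun b => PowerSeries.constantCoeff (γ b)) = a := by
    ext b; simp [hγ']
  have hlinγ : ∀ r : Fin (k + 1) → ℂ, lin r γ = PowerSeries.C (lin r a) +
      PowerSeries.X * (PowerSeries.C (lin r v) + PowerSeries.X * lin r w) := by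
    intro r
    rw [hγ', lin_add, hlinℓ, lin_const_mul]
    ring
  -- the kernel vector along the arc
  have hkerγ := isKer_critW (P := P) (Q := Q) (e := e) (s := s) (x := γ) hγI
  have hconst : ∀ b, PowerSeries.constantCoeff (aeval γ (critW P Q e s b)) =
      eval a (critW P Q e s b) := fun b => by rw [constantCoeff_aeval, hγ0]
  set c₀ := eval a (critW P Q e s (.inr j)) with hc₀
  have hdvd : ∀ b, b ≠ .inr j → ∃ z, aeval γ (critW P Q e s b) = PowerSeries.X * z := fun b hb =>
    PowerSeries.X_dvd_iff.mpr (by rw [hconst, hW0 b hb])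
  choose z hz using fun b : Fin (k + 1) => hdvd (.inl b) (by simp)
  have hq : ∀ l, ∃ q, l ≠ j → aeval γ (critW P Q e s (.inr l)) = PowerSeries.X * q := by
    intro l
    by_cases hl : l = j
    · exact ⟨0, fun h0 => absurd hl h0⟩
    · obtain ⟨q, hq⟩ := hdvd (.inr l) (by simpa using hl)
      exact ⟨q, fun _ => hq⟩
  choose q hq using hq
  have hz0 : ∀ b, PowerSeries.constantCoeff (z b) = - c₀ * y b := by
    -- Dividing the kernel equations along the arc by `X` and setting `X = 0` shows that `(z(0) + c₀
    -- y, q(0) - c₀ m)`, with `j`-th entry `0`, is in the kernel at `a`, hence zero. So the limit of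
    -- the cofactor point is `y`.
    have hu := hker0 (Sum.elim (fun b => PowerSeries.constantCoeff (z b) + c₀ * y b)
      fun l => if l = j then 0 else PowerSeries.constantCoeff (q l) - c₀ * m l) ?_ (by simp)
    · intro b
      have := hu (.inl b)
      simp only [Sum.elim_inl] at this
      linear_combination this
    · intro l r
      simp only [Sum.elim_inl, Sum.elim_inr]
      have hrow := hkerγ l r
      simp only [hz, lin_const_mul, hlinγ] at hrow
      rw [lin_add, lin_const_mul]
      by_cases hl : l = j
      · subst hl
        rw [hja, hv, map_zero, zero_add, mul_assoc, ← mul_add] at hrow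
        have h1 := congr(PowerSeries.constantCoeff $((mul_eq_zero.mp hrow).resolve_left
          PowerSeries.X_ne_zero))
        rw [map_add, map_mul, hconst, constantCoeff_lin] at h1
        simp only [map_add, PowerSeries.constantCoeff_C, map_mul, PowerSeries.constantCoeff_X,
          zero_mul, add_zero, map_zero] at h1
        rw [if_pos rfl, mul_zero, add_zero]
        linear_combination h1
      · rw [hq l hl, mul_left_comm, ← mul_add] at hrow
        have h1 := congr(PowerSeries.constantCoeff $((mul_eq_zero.mp hrow).resolve_left
          PowerSeries.X_ne_zero))
        rw [map_add, map_mul, constantCoeff_lin] at h1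
        simp only [map_add, PowerSeries.constantCoeff_C, map_mul, PowerSeries.constantCoeff_X,
          zero_mul, add_zero, map_zero] at h1
        rw [if_neg hl, hm l hl]
        linear_combination h1
  -- the open conditions hold along the arc, hence at some point
  by_contra! hcon
  let E₁ : CoordRing k := X i * critW P Q e s (.inr j)
  let E₂ : CoordRing k := ∏ l, lin (Q l (ri l)) X
  let E₃ : CoordRing k := aeval (fun b => critW P Q e s (.inl b)) G
  obtain ⟨d₁, hd₁⟩ : ∃ d, E₁.IsHomogeneous d := X_mul_critW_isHomogeneous i _
  have hd₂ : E₂.IsHomogeneous (∑ _ : Fin n, 1) :=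
    IsHomogeneous.prod _ _ _ fun l _ => lin_X_isHomogeneous _
  have hd₃ : E₃.IsHomogeneous (n * dG) := hG.aeval _ fun b => critW_inl_isHomogeneous b
  -- Nonvanishing of the product means corank one, `F ≠ 0`, all cameras defined, and `G ≠ 0` at the
  -- fibre point. If no such point existed, the product would vanish on the whole affine cone and,
  -- up to a power, lie in the ideal; it would then vanish along `γ`, although each factor is a
  -- nonzero power series there.
  have hvan : E₁ * F * E₂ * E₃ ∈ vanishingIdeal ℂ (zeroLocus ℂ (critIdeal P Q)) := by
    rw [mem_vanishingIdeal_iff]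
    intro x hx
    rw [mem_zeroLocus_iff] at hx
    by_contra hne
    have hne' : eval x (E₁ * F * E₂ * E₃) ≠ 0 := by simpa using! hne
    have hx0 : x ≠ 0 := by
      rintro rfl
      simp [E₁] at hne'
    rw [← eval_rep_mk_ne_zero_iff (((hd₁.mul hF).mul hd₂).mul hd₃) x hx0] at hne'
    set p := Projectivization.mk ℂ x hx0
    have hp : p ∈ critLocus P Q := (isConeIdeal_critIdeal P Q).mk_mem_projZeroLocus hx0
      fun f hf => by simpa using! hx f hf
    simp only [map_mul, mul_ne_zero_iff] at hne'
    obtain ⟨⟨⟨h1, h2⟩, h3⟩, h4⟩ := hne'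
    simp only [E₁, map_mul, mul_ne_zero_iff] at h1
    have hdef : IsDefinedAt Q p.rep := by
      intro l
      simp only [E₂, map_prod] at h3
      have := Finset.prod_ne_zero_iff.mp h3 l (Finset.mem_univ l)
      rw [eval_lin_X] at this
      exact ⟨_, this⟩
    obtain ⟨hw, hfib⟩ := exists_fibre_eq hp hdef h1.2
    refine hcon p _ ((hfib _).mpr rfl) h2 ?_ hdef
    rw [eval_rep_mk_ne_zero_iff hG]
    simp only [E₃, eval_aeval] at h4
    exact h4
  rw [vanishingIdeal_zeroLocus_eq_radical] at hvan
  obtain ⟨N, hN⟩ := hvan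
  have hzero : aeval γ (E₁ * F * E₂ * E₃) = 0 := by
    have := hγI _ hN
    rw [map_pow] at this
    exact eq_zero_of_pow_eq_zero this
  have hne_of_const : ∀ f : PowerSeries ℂ, PowerSeries.constantCoeff f ≠ 0 → f ≠ 0 := by
    rintro _ hf rfl
    simp at hf
  simp only [map_mul, mul_eq_zero] at hzero
  rcases hzero with ((h1 | h2) | h3) | h4
  · simp only [E₁, map_mul, aeval_X, hγi, one_mul] at h1
    exact hne_of_const _ (by rw [hconst]; exact hca) h1
  · exact hne_of_const _ (by rw [constantCoeff_aeval, hγ0]; exact hFa) h2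
  · simp only [E₂, map_prod, aeval_lin_X] at h3
    obtain ⟨l, -, hl⟩ := Finset.prod_eq_zero_iff.mp h3
    rw [hlinγ] at hl
    by_cases hlj : l = j
    · subst hlj
      rw [hja, hv, map_zero, zero_add] at hl
      refine hne_of_const _ ?_ ((mul_eq_zero.mp hl).resolve_left PowerSeries.X_ne_zero)
      simpa using (hri l).2 rfl
    · exact hne_of_const _ (by simpa using (hri l).1 hlj) hl
  · simp only [E₃] at h4
    rw [comp_aeval_apply] at h4
    simp only [hz] at h4
    rw [hG.aeval_const_mul] at h4
    refine hne_of_const _ ?_ ((mul_eq_zero.mp h4).resolve_left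
      (pow_ne_zero _ PowerSeries.X_ne_zero))
    rw [constantCoeff_aeval]
    simp only [hz0]
    rw [hG.eval_const_mul]
    exact mul_ne_zero (pow_ne_zero _ (neg_ne_zero.mpr hca)) hGy

end Deformation

/-! ### The birational map -/

section Birational

variable {k n : ℕ} {h : Fin n → ℕ} {P Q : Cameras k n h}

open Classical in
/-- The map given by the cofactors `critW P Q e s`. -/
noncomputable def cofactorMap (P Q : Cameras k n h)
    (e : Fin (k + 1) ⊕ Fin n → Σ j : Fin n, Fin (h j + 1)) (s : Fin (k + 1) ⊕ Fin n)
    (x : ProjSpace k) : ProjSpace k :=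
  if hw : (fun b => eval x.rep (critW P Q e s (.inl b))) ≠ 0 then Projectivization.mk ℂ _ hw else x

variable {e e' : Fin (k + 1) ⊕ Fin n → Σ j : Fin n, Fin (h j + 1)}
  {s s' c c' : Fin (k + 1) ⊕ Fin n}

lemma cofactorMap_spec {x : ProjSpace k} (hx : x ∈ critLocus P Q) (hQ : IsDefinedAt Q x.rep)
    (hc : eval x.rep (critW P Q e s c) ≠ 0) :
    (∃ hw : (fun b => eval x.rep (critW P Q e s (.inl b))) ≠ 0,
      cofactorMap P Q e s x = Projectivization.mk ℂ _ hw) ∧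
    ∀ y, (x, y) ∈ unifiedLocus P Q ↔ y = cofactorMap P Q e s x := by
  obtain ⟨hw, hfib⟩ := exists_fibre_eq hx hQ hc
  have heq : cofactorMap P Q e s x = Projectivization.mk ℂ _ hw := dif_pos hw
  exact ⟨⟨hw, heq⟩, fun y => by rw [heq, hfib]⟩

lemma eval_cofactorMap_ne_zero_iff {x : ProjSpace k} (hx : x ∈ critLocus P Q)
    (hQ : IsDefinedAt Q x.rep) (hc : eval x.rep (critW P Q e s c) ≠ 0) {F : CoordRing k} {d : ℕ}
    (hF : F.IsHomogeneous d) : eval (cofactorMap P Q e s x).rep F ≠ 0 ↔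
      eval x.rep (aeval (fun b => critW P Q e s (.inl b)) F) ≠ 0 := by
  obtain ⟨⟨hw, heq⟩, -⟩ := cofactorMap_spec hx hQ hc
  rw [heq, eval_rep_mk_ne_zero_iff hF, eval_aeval]

/-- On the points of the critical locus where `F` does not vanish, the fibre of the unified
critical locus is given by the cofactors. -/
def IsCofactorDomain (P Q : Cameras k n h)
    (e : Fin (k + 1) ⊕ Fin n → Σ j : Fin n, Fin (h j + 1)) (s c : Fin (k + 1) ⊕ Fin n)
    (F : CoordRing k) : Prop :=
  ∀ x ∈ critLocus P Q, eval x.rep F ≠ 0 →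
    IsDefinedAt Q x.rep ∧ eval x.rep (critW P Q e s c) ≠ 0

/-- The open set of points with `F ≠ 0` that are mapped to points with `F' ≠ 0`. -/
def cofactorOpen (P Q : Cameras k n h)
    (e : Fin (k + 1) ⊕ Fin n → Σ j : Fin n, Fin (h j + 1)) (s : Fin (k + 1) ⊕ Fin n)
    (F F' : CoordRing k) : Set (ProjSpace k) :=
  {x | eval x.rep F ≠ 0 ∧ eval x.rep (aeval (fun b => critW P Q e s (.inl b)) F') ≠ 0}

lemma isOpen_cofactorOpen {F F' : CoordRing k} {d d' : ℕ} (hF : F.IsHomogeneous d)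
    (hF' : F'.IsHomogeneous d') : IsOpen (cofactorOpen P Q e s F F') :=
  (isOpen_setOf_eval_ne_zero hF).inter
    (isOpen_setOf_eval_ne_zero (hF'.aeval _ fun b => critW_inl_isHomogeneous b))

/-- The image of `x` lies in the opposite domain, where fibres are single points; the fibre over it
contains `x`, so the opposite cofactor map leads back to `x`. -/
lemma cofactorMap_mem {F F' : CoordRing k} {d d' : ℕ} (hF : F.IsHomogeneous d)
    (hF' : F'.IsHomogeneous d') (hD : IsCofactorDomain P Q e s c F)
    (hD' : IsCofactorDomain Q P e' s' c' F') {x : ProjSpace k} (hx : x ∈ critLocus P Q)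
    (hxA : x ∈ cofactorOpen P Q e s F F') :
    cofactorMap P Q e s x ∈ critLocus Q P ∧
      cofactorMap P Q e s x ∈ cofactorOpen Q P e' s' F' F ∧
      cofactorMap Q P e' s' (cofactorMap P Q e s x) = x := by
  obtain ⟨hQ, hc⟩ := hD x hx hxA.1
  have hU := ((cofactorMap_spec hx hQ hc).2 _).mpr rfl
  have hy := hU.2.1
  have hF'y := (eval_cofactorMap_ne_zero_iff hx hQ hc hF').mpr hxA.2
  obtain ⟨hP, hc'⟩ := hD' _ hy hF'y
  have hback := ((cofactorMap_spec hy hP hc').2 x).mp (mem_unifiedLocus_swap.mp hU)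
  refine ⟨hy, ⟨hF'y, (eval_cofactorMap_ne_zero_iff hy hP hc' hF).mp ?_⟩, hback.symm⟩
  rw [← hback]
  exact hxA.1

lemma isRegularMapOn_cofactorMap {F : CoordRing k} (hD : IsCofactorDomain P Q e s c F)
    {A : Set (ProjSpace k)} (hA : ∀ x ∈ A, x ∈ critLocus P Q ∧ eval x.rep F ≠ 0) :
    IsRegularMapOn (cofactorMap P Q e s) A := by
  refine fun a _ => ⟨Set.univ, isOpen_univ, trivial, n, fun b => critW P Q e s (.inl b),
    fun b => critW_inl_isHomogeneous b, fun x hx => ?_⟩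
  obtain ⟨hxl, hxF⟩ := hA x hx.2
  obtain ⟨hQ, hc⟩ := hD x hxl hxF
  exact (cofactorMap_spec hxl hQ hc).1

/-- Birationality follows from a single point of the unified critical locus both of whose
projections lie in cofactor domains. -/
lemma isBirationalVia_of_mem {X' Y' : Set (ProjSpace k)} {F F' : CoordRing k} {d d' : ℕ}
    (hF : F.IsHomogeneous d) (hF' : F'.IsHomogeneous d')
    (hD : IsCofactorDomain P Q e s c F) (hD' : IsCofactorDomain Q P e' s' c' F')
    (hX' : X' ⊆ critLocus P Q) (hY' : Y' ⊆ critLocus Q P)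
    (hFX : ∀ x ∈ critLocus P Q, eval x.rep F ≠ 0 → x ∈ X')
    (hFY : ∀ y ∈ critLocus Q P, eval y.rep F' ≠ 0 → y ∈ Y')
    {x y : ProjSpace k} (hU : (x, y) ∈ unifiedLocus P Q) (hx : eval x.rep F ≠ 0)
    (hy : eval y.rep F' ≠ 0) : IsBirationalVia (unifiedLocus P Q) X' Y' := by
  obtain ⟨hQ, hc⟩ := hD x hU.1 hx
  have hxA : x ∈ cofactorOpen P Q e s F F' := by
    refine ⟨hx, (eval_cofactorMap_ne_zero_iff hU.1 hQ hc hF').mp ?_⟩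
    rwa [← ((cofactorMap_spec hU.1 hQ hc).2 y).mp hU]
  refine ⟨cofactorOpen P Q e s F F' ∩ X', cofactorOpen Q P e' s' F' F ∩ Y',
    cofactorMap P Q e s, cofactorMap Q P e' s',
    ⟨⟨x, hxA, hFX x hU.1 hx⟩, _, isOpen_cofactorOpen hF hF', rfl⟩, ⟨⟨cofactorMap P Q e s x, ?_⟩,
      _, isOpen_cofactorOpen hF' hF, rfl⟩,
    isRegularMapOn_cofactorMap hD fun z hz => ⟨hX' hz.2, hz.1.1⟩,
    isRegularMapOn_cofactorMap hD' fun z hz => ⟨hY' hz.2, hz.1.1⟩, fun z hz => ?_, fun z hz => ?_,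
    ⟨fun z hz => ?_, fun z hz => ?_⟩, fun z hz w => ?_, fun z hz w => ?_⟩
  · have := cofactorMap_mem hF hF' hD hD' hU.1 hxA
    exact ⟨this.2.1, hFY _ this.1 this.2.1.1⟩
  · have := cofactorMap_mem hF hF' hD hD' (hX' hz.2) hz.1
    exact ⟨this.2.1, hFY _ this.1 this.2.1.1⟩
  · have := cofactorMap_mem hF' hF hD' hD (hY' hz.2) hz.1
    exact ⟨this.2.1, hFX _ this.1 this.2.1.1⟩
  · exact (cofactorMap_mem hF hF' hD hD' (hX' hz.2) hz.1).2.2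
  · exact (cofactorMap_mem hF' hF hD' hD (hY' hz.2) hz.1).2.2
  · obtain ⟨hQ, hc⟩ := hD z (hX' hz.2) hz.1.1
    exact (cofactorMap_spec (hX' hz.2) hQ hc).2 w
  · obtain ⟨hP, hc⟩ := hD' z (hY' hz.2) hz.1.1
    rw [mem_unifiedLocus_swap]
    exact (cofactorMap_spec (hY' hz.2) hP hc).2 w

/-- A point where the cameras are defined has a neighbourhood given by a form where they are. -/
lemma IsDefinedAt.exists_form {x : ProjSpace k} (hx : IsDefinedAt Q x.rep) :
    ∃ (d : ℕ) (L : CoordRing k), L.IsHomogeneous d ∧ eval x.rep L ≠ 0 ∧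
      ∀ y : ProjSpace k, eval y.rep L ≠ 0 → IsDefinedAt Q y.rep := by
  choose r hr using hx
  refine ⟨_, ∏ l, lin (Q l (r l)) X, IsHomogeneous.prod _ _ _ fun l _ => lin_X_isHomogeneous _,
    ?_, fun y hy l => ⟨r l, ?_⟩⟩
  · rw [map_prod]
    exact Finset.prod_ne_zero_iff.mpr fun l _ => by rw [eval_lin_X]; exact hr l
  · rw [map_prod] at hy
    have := Finset.prod_ne_zero_iff.mp hy l (Finset.mem_univ l)
    rwa [eval_lin_X] at this

/-- Near a smooth point of corank one on the component `X'` all points of the critical locus are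
such points. -/
lemma exists_form_of_smooth {X' : Set (ProjSpace k)} (hX' : IsIrredComponent X' (critLocus P Q))
    {x : ProjSpace k} (hx : x ∈ X') (hs : IsSmoothPoint (critIdeal P Q) x)
    (hcof : HasCofactor P Q x.rep) : ∃ (d : ℕ) (F : CoordRing k), F.IsHomogeneous d ∧
      eval x.rep F ≠ 0 ∧ ∃ e s c, ∀ z ∈ critLocus P Q, eval z.rep F ≠ 0 →
        z ∈ X' ∧ IsSmoothPoint (critIdeal P Q) z ∧ eval z.rep (critW P Q e s c) ≠ 0 := by
  obtain ⟨d, G, hG, hGx, hGZ⟩ :=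
    exists_nhds_subset_component (isConeIdeal_critIdeal P Q) hX' hx hs
  obtain ⟨e, s, c, hc⟩ := hcof
  obtain ⟨i, hi⟩ := Function.ne_iff.mp x.rep_nonzero
  obtain ⟨d', hd'⟩ := X_mul_critW_isHomogeneous (P := P) (Q := Q) (e := e) (s := s) i c
  -- The factor `X i`, nonzero at `x`, makes the cofactor homogeneous by
  -- `X_mul_critW_isHomogeneous`.
  refine ⟨_, G * (X i * critW P Q e s c), hG.mul hd', ?_, e, s, c, fun z hz hzF => ?_⟩
  · rw [map_mul, map_mul, eval_X]
    exact mul_ne_zero hGx (mul_ne_zero hi hc)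
  · rw [map_mul, map_mul] at hzF
    obtain ⟨h1, h2⟩ := hGZ z hz (left_ne_zero_of_mul hzF)
    exact ⟨h1, h2, right_ne_zero_of_mul (right_ne_zero_of_mul hzF)⟩

/-- Without cameras the critical locus is the whole space. -/
lemma critLocus_eq_univ_of_isEmpty {h : Fin 0 → ℕ} (P Q : Cameras k 0 h) :
    critLocus P Q = Set.univ := by
  refine Set.eq_univ_of_forall fun x f hf => ?_
  have hle : critIdeal P Q ≤ RingHom.ker (eval x.rep) := by
    refine Ideal.span_le.mpr ?_
    rintro _ ⟨e, rfl⟩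
    exact (e (.inl 0)).1.elim0
  exact hle hf

/-- Settles the case of no cameras, where the rank condition forces `k = 0`. -/
lemma isBirationalVia_of_subsingleton [Subsingleton (ProjSpace k)]
    {Γ : Set (ProjSpace k × ProjSpace k)} {X' Y' : Set (ProjSpace k)} {x y : ProjSpace k}
    (hx : x ∈ X') (hy : y ∈ Y') (hΓ : (x, y) ∈ Γ) : IsBirationalVia Γ X' Y' := by
  have hXu : ∀ z, z ∈ X' := fun z => Subsingleton.elim x z ▸ hx
  have hYu : ∀ z, z ∈ Y' := fun z => Subsingleton.elim y z ▸ hy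
  have hΓu : ∀ z w, (z, w) ∈ Γ := fun z w =>
    Subsingleton.elim x z ▸ Subsingleton.elim y w ▸ hΓ
  have hreg : ∀ A : Set (ProjSpace k), IsRegularMapOn (id : ProjSpace k → ProjSpace k) A :=
    fun A a _ => ⟨Set.univ, isOpen_univ, trivial, 1, X, fun i => isHomogeneous_X _ _,
      fun z _ => ⟨by simpa using z.rep_nonzero, Subsingleton.elim _ _⟩⟩
  exact ⟨X', Y', id, id, ⟨⟨x, hx⟩, _, isOpen_univ, (Set.univ_inter _).symm⟩,
    ⟨⟨y, hy⟩, _, isOpen_univ, (Set.univ_inter _).symm⟩, hreg _, hreg _, fun z _ => hYu z,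
    fun z _ => hXu z, ⟨fun z _ => rfl, fun z _ => rfl⟩,
    fun z _ w => iff_of_true (hΓu z w) (Subsingleton.elim _ _),
    fun z _ w => iff_of_true (hΓu w z) (Subsingleton.elim _ _)⟩

lemma subsingleton_projSpace_zero : Subsingleton (ProjSpace 0) := by
  refine ⟨fun x y => ?_⟩
  have hy0 : y.rep 0 ≠ 0 := fun h0 => y.rep_nonzero (by
    ext i
    obtain rfl : i = 0 := Subsingleton.elim (α := Fin 1) i 0
    exact h0)
  rw [← x.mk_rep, ← y.mk_rep, Projectivization.mk_eq_mk_iff']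
  refine ⟨x.rep 0 / y.rep 0, ?_⟩
  ext i
  obtain rfl : i = 0 := Subsingleton.elim (α := Fin 1) i 0
  rw [Pi.smul_apply, smul_eq_mul, div_mul_cancel₀ _ hy0]

end Birational

end CriticalLoci

/-! ### Proof of the theorem: two successive deformations of the given point. -/

theorem theorem4 {k n : ℕ} {h : Fin n → ℕ} (P Q : CriticalLoci.Cameras k n h)
    (hP : CriticalLoci.AreProjections P) (hQ : CriticalLoci.AreProjections Q)
    (X' Y' : Set (CriticalLoci.ProjSpace k))
    (hX' : CriticalLoci.IsIrredComponent X' (CriticalLoci.critLocus P Q))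
    (hY' : CriticalLoci.IsIrredComponent Y' (CriticalLoci.critLocus Q P))
    (x₀ y₀ : CriticalLoci.ProjSpace k)
    (hU : (x₀, y₀) ∈ CriticalLoci.unifiedLocus P Q)
    (hx₀ : x₀ ∈ X') (hy₀ : y₀ ∈ Y')
    (hx₀s : CriticalLoci.IsSmoothPoint (CriticalLoci.critIdeal P Q) x₀)
    (hy₀s : CriticalLoci.IsSmoothPoint (CriticalLoci.critIdeal Q P) y₀)
    -- if a critical locus is the whole space, smoothness carries no information and the matrix
    -- is required to have the expected rank at the given point
    (hx₀r : CriticalLoci.critLocus P Q = Set.univ → CriticalLoci.critRank P Q x₀ = k + n)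
    (hy₀r : CriticalLoci.critLocus Q P = Set.univ → CriticalLoci.critRank Q P y₀ = k + n) :
    CriticalLoci.IsBirationalVia (CriticalLoci.unifiedLocus P Q) X' Y' := by
  open CriticalLoci in
  rcases eq_or_ne n 0 with rfl | hn
  · have hr := hx₀r (critLocus_eq_univ_of_isEmpty P Q)
    have hk : k = 0 := by
      have := Matrix.rank_le_card_height ((critMatrix P Q).map (eval x₀.rep))
      rw [← critRank, hr] at this
      simpa using this
    subst hk
    have := subsingleton_projSpace_zero
    exact isBirationalVia_of_subsingleton hx₀ hy₀ hU
  obtain ⟨dF, F, hF, hFx, e, s, c, hFD⟩ :=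
    exists_form_of_smooth hX' hx₀ hx₀s (hx₀s.hasCofactor hn hx₀r)
  obtain ⟨dG, G, hG, hGy, e', s', c', hGD⟩ :=
    exists_form_of_smooth hY' hy₀ hy₀s (hy₀s.hasCofactor hn hy₀r)
  obtain ⟨x₁, y₁, hU₁, hFx₁, hGy₁, hdef₁⟩ := exists_mem_unifiedLocus_isDefinedAt hQ hU hx₀s
    (hx₀s.hasCofactor hn hx₀r) hF hG hFx hGy
  -- `L` records that the `Q_j` are defined; passing `F * L` to the second deformation preserves
  -- this while the `P_j` become defined at the other point.
  obtain ⟨dL, L, hL, hLx, hLD⟩ := hdef₁.exists_form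
  obtain ⟨-, hs₁, hc₁⟩ := hGD y₁ hU₁.2.1 hGy₁
  obtain ⟨y₂, x₂, hU₂, hGy₂, hFL, hdef₂⟩ := exists_mem_unifiedLocus_isDefinedAt hP
    (mem_unifiedLocus_swap.mp hU₁) hs₁ ⟨_, _, _, hc₁⟩ hG (hF.mul hL) hGy₁
    (by rw [map_mul]; exact mul_ne_zero hFx₁ hLx)
  obtain ⟨dL', L', hL', hLy, hLD'⟩ := hdef₂.exists_form
  have split : ∀ {z : ProjSpace k} {f g : CoordRing k}, eval z.rep (f * g) ≠ 0 →
      eval z.rep f ≠ 0 ∧ eval z.rep g ≠ 0 := fun hz => by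
    rwa [map_mul, mul_ne_zero_iff] at hz
  refine isBirationalVia_of_mem (F := F * L) (F' := G * L') (hF.mul hL) (hG.mul hL')
    (e := e) (s := s) (c := c) (e' := e') (s' := s') (c' := c')
    (fun z hz hzF => ⟨hLD z (split hzF).2, (hFD z hz (split hzF).1).2.2⟩)
    (fun z hz hzG => ⟨hLD' z (split hzG).2, (hGD z hz (split hzG).1).2.2⟩)
    hX'.prop.2 hY'.prop.2 (fun z hz hzF => (hFD z hz (split hzF).1).1)
    (fun z hz hzG => (hGD z hz (split hzG).1).1) (mem_unifiedLocus_swap.mpr hU₂) hFL ?_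
  rw [map_mul]
  exact mul_ne_zero hGy₂ hLy
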